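/- Let $l$ be a positive integer and let $\mathrm{QSym}^{(l)}=\bigoplus_{\mathbf n\in\mathbb N^l}\mathrm{QSym}^{(l)}_{\mathbf n}$ be the multigraded Hopf algebra over $\mathbb Q$ of quasisymmetric functions of level $l$: the formal power series of finite degree in commuting variables $x_j^{(i)}$ ($0\le i<l$, $j\ge 1$) such that, for all nonzero $\mathbf i_1,\dots,\mathbf i_m\in\mathbb N^l$ and all $j_1<\dots<j_m$, the coefficients of $\mathbf x_{j_1}^{\mathbf i_1}\cdots\mathbf x_{j_m}^{\mathbf i_m}$ and $\mathbf x_{1}^{\mathbf i_1}\cdots\mathbf x_{m}^{\mathbf i_m}$ agree, where $\mathbf x_j^{\mathbf n}=\prod_i (x_j^{(i)})^{n_i}$; the multidegree of such a monomial is $\mathbf i_1+\dots+\mathbf i_m$. It has the basis $M_{(\mathbf i_1,\dots,\mathbf i_m)}=\sum_{j_1<\dots<j_m}\mathbf x_{j_1}^{\mathbf i_1}\cdots\mathbf x_{j_m}^{\mathbf i_m}$, indexed by all finite sequences (vector compositions) of nonzero elements of $\mathbb N^l$; its coproduct is $\Delta(M_{(\mathbf i_1,\dots,\mathbf i_m)})=\sum_{r=0}^m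 M_{(\mathbf i_1,\dots,\mathbf i_r)}\otimes M_{(\mathbf i_{r+1},\dots,\mathbf i_m)}$ and its counit is the projection onto multidegree $\mathbf 0$. Let $\zeta:\mathrm{QSym}^{(l)}\to\mathbb Q$ be the universal character, $\zeta(M_I)=1$ if $I$ has at most one column and $\zeta(M_I)=0$ otherwise; let $\zeta^{-1}$ be its inverse under convolution, and let $\bar\zeta(h)=(-1)^{|\mathbf n|}\zeta(h)$ for $h\in \mathrm{QSym}^{(l)}_{\mathbf n}$, where $|\mathbf n|=\sum_i n_i$. For $\mathbf k=(k_0,\dots,k_{l-1})\in(\mathbb N\cup\{\infty\})^l$ let $\mathcal O^{\mathbf k}$ be the $\mathbf k$-odd Hopf subalgebra of $\mathrm{QSym}^{(l)}$, i.e. the largest graded subcoalgebra $C$ of $\mathrm{QSym}^{(l)}$ such that $\bar\zeta(h)=\zeta^{-1}(h)$ for all $h\in C\cap\bigoplus_{\mathbf n\le\mathbf k}\mathrm{QSym}^{(l)}_{\mathbf n}$ (with $\mathbf n\in\mathbb N^l$ and $\le$ componentwise), and let $(\mathcal O^{\mathbf k})_{\mathbf n}=\mathcal O^{\mathbf k}\cap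 \mathrm{QSym}^{(l)}_{\mathbf n}$. Then every $(\mathcal O^{\mathbf k})_{\mathbf n}$ is finite-dimensional and, as formal power series in $t_0,\dots,t_{l-1}$ over $\mathbb Q$, with $t^{\mathbf n}=\prod_{i}t_i^{n_i}$, $$\sum_{\mathbf n\in\mathbb N^l}\dim\big((\mathcal O^{\mathbf k})_{\mathbf n}\big)\,t^{\mathbf n}=\frac{\displaystyle\prod_{i=0}^{l-1}(1-t_i^2)}{\displaystyle\prod_{i=0}^{l-1}(1-t_i^2)-\prod_{i=0}^{l-1}(1+t_i)+\sum_{\substack{\mathbf b\in\{0,1\}^l\\ |\mathbf b|\text{ even}}}\ \prod_{i=0}^{l-1}t_i^{b_i}\Big(1-t_i^{2\lfloor (k_i-b_i)/2\rfloor+2}\Big)},$$ where the denominator is a polynomial that is invertible as a formal power series, and the term $t_i^{2\lfloor (k_i-b_i)/2\rfloor+2}$ is taken to be $0$ when $k_i=\infty$. -/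

import Mathlib

open scoped TensorProduct DirectSum

noncomputable section

namespace LevelQSym

/-! ### Multigraded coalgebras: the largest graded subcoalgebra on which two functionals agree -/

/-- The weight `|n| = ∑ i, n i` of an `l`-partite number. -/
def weight {l : ℕ} (n : Fin l → ℕ) : ℕ := ∑ i, n i

/-- The relation `n ≤ k` for an `l`-partite number `n` and `k ∈ (ℕ ∪ {∞})^l`. -/
def BoundedBy {l : ℕ} (k : Fin l → ℕ∞) (n : Fin l → ℕ) : Prop := ∀ i, (n i : ℕ∞) ≤ k i

section Graded

variable {l : ℕ} {H : Type*} [AddCommGroup H] [Module ℚ H]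
  (𝒜 : (Fin l → ℕ) → Submodule ℚ H) [DirectSum.Decomposition 𝒜]

/-- `φ̄`, the functional with `φ̄ h = (-1)^|n| φ h` for `h` homogeneous of multidegree `n`. -/
def bar (φ : H →ₗ[ℚ] ℚ) : H →ₗ[ℚ] ℚ :=
  DirectSum.toModule ℚ (Fin l → ℕ) ℚ
      (fun n => ((-1 : ℚ) ^ weight n) • (φ ∘ₗ (𝒜 n).subtype)) ∘ₗ
    (DirectSum.decomposeLinearEquiv 𝒜).toLinearMap

/-- The inverse of `φ` for the convolution product of linear functionals
(it is the genuine inverse whenever `φ` is invertible). -/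
def convInv [Coalgebra ℚ H] (φ : H →ₗ[ℚ] ℚ) : H →ₗ[ℚ] ℚ :=
  (Ring.inverse (WithConv.toConv φ)).ofConv

/-- A graded subcoalgebra: a graded subspace `C` with `Δ C ⊆ C ⊗ C`. -/
structure IsGradedSubcoalgebra [Coalgebra ℚ H] (C : Submodule ℚ H) : Prop where
  homogeneous : DirectSum.SetLike.IsHomogeneous 𝒜 C
  comul_mem : ∀ h ∈ C,
    (Coalgebra.comul h : H ⊗[ℚ] H) ∈ LinearMap.range (TensorProduct.map C.subtype C.subtype)

/-- The graded subcoalgebras `C` such that `φ = ψ` on `C ∩ ⨁_{n ≤ k} H_n`. -/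
def agreeingSubcoalgebras [Coalgebra ℚ H] (k : Fin l → ℕ∞) (φ ψ : H →ₗ[ℚ] ℚ) :
    Set (Submodule ℚ H) :=
  {C | IsGradedSubcoalgebra 𝒜 C ∧
    ∀ h ∈ C, h ∈ ⨆ n : {n : Fin l → ℕ // BoundedBy k n}, 𝒜 n.1 → φ h = ψ h}

/-- `S_k(φ, ψ)`, the largest graded subcoalgebra `C` such that `φ = ψ` on
`C ∩ ⨁_{n ≤ k} H_n`; see `isGreatest_largestAgreeing`. -/
def largestAgreeing [Coalgebra ℚ H] (k : Fin l → ℕ∞) (φ ψ : H →ₗ[ℚ] ℚ) : Submodule ℚ H :=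
  sSup (agreeingSubcoalgebras 𝒜 k φ ψ)

/-- The projection onto the homogeneous component of multidegree `n`. -/
def homProj (n : Fin l → ℕ) : H →ₗ[ℚ] H :=
  (𝒜 n).subtype ∘ₗ DirectSum.component ℚ (Fin l → ℕ) (fun i => 𝒜 i) n ∘ₗ
    (DirectSum.decomposeLinearEquiv 𝒜).toLinearMap

theorem homProj_apply (n : Fin l → ℕ) (h : H) :
    homProj 𝒜 n h = (DirectSum.decompose 𝒜 h n : H) := rfl

theorem isGreatest_largestAgreeing [Coalgebra ℚ H] (k : Fin l → ℕ∞) (φ ψ : H →ₗ[ℚ] ℚ) :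
    IsGreatest (agreeingSubcoalgebras 𝒜 k φ ψ) (largestAgreeing 𝒜 k φ ψ) := by
  refine ⟨⟨⟨?_, ?_⟩, ?_⟩, fun C hC => le_sSup hC⟩
  · intro n
    have : largestAgreeing 𝒜 k φ ψ ≤ (largestAgreeing 𝒜 k φ ψ).comap (homProj 𝒜 n) := by
      refine sSup_le fun C hC h hh => ?_
      exact (le_sSup hC : C ≤ _) (hC.1.homogeneous n hh)
    exact fun h hh => this hh
  · have : largestAgreeing 𝒜 k φ ψ ≤ (LinearMap.range (TensorProduct.map
        (largestAgreeing 𝒜 k φ ψ).subtype (largestAgreeing 𝒜 k φ ψ).subtype)).comap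
          Coalgebra.comul := by
      refine sSup_le fun C hC h hh => ?_
      obtain ⟨t, ht⟩ := hC.1.comul_mem h hh
      have hle : C ≤ largestAgreeing 𝒜 k φ ψ := le_sSup hC
      refine ⟨TensorProduct.map (Submodule.inclusion hle) (Submodule.inclusion hle) t, ?_⟩
      rw [← ht, ← LinearMap.comp_apply, ← TensorProduct.map_comp]
      rfl
    exact fun h hh => this hh
  · have key : largestAgreeing 𝒜 k φ ψ ≤
        ⨅ n : {n : Fin l → ℕ // BoundedBy k n}, LinearMap.ker ((φ - ψ) ∘ₗ homProj 𝒜 n.1) := by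
      refine sSup_le fun C hC h hh => ?_
      rw [Submodule.mem_iInf]
      intro n
      have h1 : homProj 𝒜 n.1 h ∈ C := hC.1.homogeneous n.1 hh
      have h2 : homProj 𝒜 n.1 h ∈ ⨆ n : {n : Fin l → ℕ // BoundedBy k n}, 𝒜 n.1 :=
        Submodule.mem_iSup_of_mem n (DirectSum.decompose 𝒜 h n.1).2
      simp [hC.2 _ h1 h2]
    intro h hh hk
    have h3 := key hh
    rw [Submodule.mem_iInf] at h3
    have h4 : ∀ n, ¬ BoundedBy k n → homProj 𝒜 n h = 0 := by
      intro n hn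
      have : (⨆ n : {n : Fin l → ℕ // BoundedBy k n}, 𝒜 n.1) ≤ LinearMap.ker (homProj 𝒜 n) := by
        refine iSup_le fun m x hx => ?_
        have hmn : m.1 ≠ n := fun e => hn (e ▸ m.2)
        rw [LinearMap.mem_ker, homProj_apply, DirectSum.decompose_of_mem_ne 𝒜 hx hmn]
      exact this hk
    have h5 : ∀ n, (φ - ψ) (homProj 𝒜 n h) = 0 := by
      intro n
      by_cases hn : BoundedBy k n
      · exact h3 ⟨n, hn⟩
      · rw [h4 n hn, map_zero]
    classical
    have h6 := DirectSum.sum_support_decompose 𝒜 h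
    have : (φ - ψ) h = 0 := by
      rw [← h6, map_sum]
      exact Finset.sum_eq_zero fun n _ => h5 n
    exact sub_eq_zero.mp this

/-- The `k`-odd subcoalgebra `S_k(φ̄, φ⁻¹)` of a multigraded coalgebra with functional `φ`. -/
def kOddOf [Coalgebra ℚ H] (k : Fin l → ℕ∞) (φ : H →ₗ[ℚ] ℚ) : Submodule ℚ H :=
  largestAgreeing 𝒜 k (bar 𝒜 φ) (convInv φ)

end Graded

/-! ### Quasisymmetric functions of level `l` -/

/-- Vector compositions: finite sequences of nonzero `l`-partite numbers (the columns). -/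
abbrev VComp (l : ℕ) := List {n : Fin l → ℕ // n ≠ 0}

/-- The sum of the columns of a vector composition. -/
def VComp.total {l : ℕ} (I : VComp l) : Fin l → ℕ := (I.map Subtype.val).sum

/-- The exponent of the monomial `x_{j 0}^{c 0} ⋯ x_{j (m-1)}^{c (m-1)}`, in the variables
`x_p^{(i)}` of color `i : Fin l` and position `p : ℕ`. -/
def place {l m : ℕ} (c : Fin m → (Fin l → ℕ)) (j : Fin m → ℕ) : (Fin l × ℕ) →₀ ℕ :=
  ∑ r, ∑ i, Finsupp.single (i, j r) (c r i)

/-- The exponent of `x_{j 0}^{I_0} ⋯ x_{j (m-1)}^{I_{m-1}}` for a vector composition `I`. -/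
def VComp.exponent {l : ℕ} (I : VComp l) (j : Fin I.length → ℕ) : (Fin l × ℕ) →₀ ℕ :=
  place (fun r => (I.get r).1) j

/-- The exponent of `x_0^{I_0} ⋯ x_{m-1}^{I_{m-1}}`. -/
def VComp.initExponent {l : ℕ} (I : VComp l) : (Fin l × ℕ) →₀ ℕ :=
  I.exponent (fun r => (r : ℕ))

/-- The space of quasisymmetric functions of level `l`: formal power series of finite degree
in the colored variables, for which the coefficient of `x_{j_1}^{I_1} ⋯ x_{j_m}^{I_m}`,
`j_1 < ⋯ < j_m`, depends only on the vector composition `I`. -/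
def QSym (l : ℕ) : Submodule ℚ (MvPowerSeries (Fin l × ℕ) ℚ) where
  carrier := {f | (∃ N : ℕ, ∀ d, MvPowerSeries.coeff d f ≠ 0 → d.degree ≤ N) ∧
    ∀ (I : VComp l) (j : Fin I.length → ℕ), StrictMono j →
      MvPowerSeries.coeff (I.exponent j) f = MvPowerSeries.coeff I.initExponent f}
  zero_mem' := ⟨⟨0, fun d hd => absurd (map_zero _) hd⟩, fun I j _ => by simp⟩
  add_mem' := by
    rintro f g ⟨⟨N, hN⟩, hf⟩ ⟨⟨N', hN'⟩, hg⟩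
    refine ⟨⟨max N N', fun d hd => ?_⟩, fun I j hj => by rw [map_add, map_add, hf I j hj, hg I j hj]⟩
    by_contra hlt
    rw [not_le, max_lt_iff] at hlt
    have h1 : MvPowerSeries.coeff d f = 0 := by
      by_contra h; exact absurd (hN d h) (not_le.mpr hlt.1)
    have h2 : MvPowerSeries.coeff d g = 0 := by
      by_contra h; exact absurd (hN' d h) (not_le.mpr hlt.2)
    exact hd (by rw [map_add, h1, h2, add_zero])
  smul_mem' := by
    rintro a f ⟨⟨N, hN⟩, hf⟩
    refine ⟨⟨N, fun d hd => hN d fun h => hd ?_⟩, fun I j hj => ?_⟩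
    · rw [MvPowerSeries.coeff_smul, h, mul_zero]
    · rw [MvPowerSeries.coeff_smul, MvPowerSeries.coeff_smul, hf I j hj]

/-- The multidegree of a monomial: the vector of its total degrees in the variables of
each color. -/
def mdeg {l : ℕ} (d : (Fin l × ℕ) →₀ ℕ) : Fin l → ℕ :=
  fun i => d.sum fun p a => if p.1 = i then a else 0

/-- The multigraded component of multidegree `n` of `QSym l`. -/
def component {l : ℕ} (n : Fin l → ℕ) : Submodule ℚ (QSym l) where
  carrier := {f | ∀ d, MvPowerSeries.coeff d f.1 ≠ 0 → mdeg d = n}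
  zero_mem' := fun d hd => absurd (map_zero _) hd
  add_mem' := by
    intro f g hf hg d hd
    by_cases h : MvPowerSeries.coeff d f.1 = 0
    · refine hg d fun h' => hd ?_
      change MvPowerSeries.coeff d (f.1 + g.1) = 0
      rw [map_add, h, h', add_zero]
    · exact hf d h
  smul_mem' := by
    intro a f hf d hd
    refine hf d fun h => hd ?_
    change MvPowerSeries.coeff d (a • f.1) = 0
    rw [MvPowerSeries.coeff_smul, h, mul_zero]

/-! Combinatorics of exponents. -/

theorem place_apply {l m : ℕ} (c : Fin m → (Fin l → ℕ)) (j : Fin m → ℕ) (i : Fin l) (p : ℕ) :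
    place c j (i, p) = ∑ r, if j r = p then c r i else 0 := by
  simp only [place, Finsupp.coe_finsetSum, Finset.sum_apply, Finsupp.single_apply, Prod.mk.injEq]
  refine Finset.sum_congr rfl fun r _ => ?_
  by_cases h : j r = p <;> simp [h]

theorem place_apply_self {l m : ℕ} (c : Fin m → (Fin l → ℕ)) {j : Fin m → ℕ}
    (hj : Function.Injective j) (i : Fin l) (r : Fin m) : place c j (i, j r) = c r i := by
  rw [place_apply, Finset.sum_eq_single r]
  · simp
  · intro s _ hs
    rw [if_neg fun h => hs (hj h)]
  · simp

theorem place_apply_of_notMem {l m : ℕ} (c : Fin m → (Fin l → ℕ)) {j : Fin m → ℕ}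
    (i : Fin l) {p : ℕ} (hp : p ∉ Set.range j) : place c j (i, p) = 0 := by
  rw [place_apply]
  exact Finset.sum_eq_zero fun r _ => if_neg fun h => hp ⟨r, h⟩

theorem place_range {l m : ℕ} {c : Fin m → (Fin l → ℕ)} (hc : ∀ r, c r ≠ 0) {j : Fin m → ℕ}
    (hj : Function.Injective j) : {p | ∃ i, place c j (i, p) ≠ 0} = Set.range j := by
  ext p
  constructor
  · rintro ⟨i, hi⟩
    by_contra h
    exact hi (place_apply_of_notMem c i h)
  · rintro ⟨r, rfl⟩
    obtain ⟨i, hi⟩ := Function.ne_iff.mp (hc r)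
    exact ⟨i, by rw [place_apply_self c hj]; exact hi⟩

theorem place_inj {l m m' : ℕ} {c : Fin m → {n : Fin l → ℕ // n ≠ 0}}
    {c' : Fin m' → {n : Fin l → ℕ // n ≠ 0}} {j : Fin m → ℕ} {j' : Fin m' → ℕ}
    (hj : StrictMono j) (hj' : StrictMono j')
    (h : place (fun r => (c r).1) j = place (fun r => (c' r).1) j') :
    List.ofFn c = List.ofFn c' := by
  have hr : Set.range j = Set.range j' := by
    rw [← place_range (fun r => (c r).2) hj.injective,
      ← place_range (fun r => (c' r).2) hj'.injective, h]
  have hm : m = m' := by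
    have h1 := Set.ncard_range_of_injective hj.injective
    have h2 := Set.ncard_range_of_injective hj'.injective
    rw [hr, h2] at h1
    simpa using h1.symm
  subst hm
  have hjj : j = j' := (StrictMono.range_inj hj hj').mp hr
  subst hjj
  congr 1
  funext r
  apply Subtype.ext
  funext i
  rw [← place_apply_self (fun r => (c r).1) hj.injective i r, h,
    place_apply_self (fun r => (c' r).1) hj.injective i r]

theorem exponent_inj {l : ℕ} {I J : VComp l} {j : Fin I.length → ℕ} {j' : Fin J.length → ℕ}
    (hj : StrictMono j) (hj' : StrictMono j') (h : I.exponent j = J.exponent j') : I = J := by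
  have := place_inj (c := I.get) (c' := J.get) hj hj' h
  simpa using this

theorem strictMono_val (m : ℕ) : StrictMono (fun r : Fin m => (r : ℕ)) := fun _ _ h => h

theorem exists_exponent_eq {l : ℕ} (d : (Fin l × ℕ) →₀ ℕ) :
    ∃ (I : VComp l) (j : Fin I.length → ℕ), StrictMono j ∧ I.exponent j = d := by
  classical
  let S : Finset ℕ := d.support.image Prod.snd
  let e := S.orderEmbOfFin rfl
  have hne : ∀ r, (fun i => d (i, e r)) ≠ (0 : Fin l → ℕ) := by
    intro r h
    have hm : e r ∈ S := S.orderEmbOfFin_mem rfl r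
    obtain ⟨⟨i, p⟩, hp, hpe⟩ := Finset.mem_image.mp hm
    have : p = e r := hpe
    subst this
    exact Finsupp.mem_support_iff.mp hp (congrFun h i)
  let c : Fin S.card → {n : Fin l → ℕ // n ≠ 0} := fun r => ⟨fun i => d (i, e r), hne r⟩
  have hl : (List.ofFn c).length = S.card := List.length_ofFn
  have hmono : StrictMono (fun r : Fin (List.ofFn c).length => e (Fin.cast hl r)) :=
    fun a b hab => e.strictMono hab
  refine ⟨List.ofFn c, _, hmono, ?_⟩
  ext ⟨i, p⟩
  by_cases hp : p ∈ Set.range (fun r : Fin (List.ofFn c).length => e (Fin.cast hl r))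
  · obtain ⟨r, rfl⟩ := hp
    rw [VComp.exponent, place_apply_self _ hmono.injective]
    simp only [c, List.get_ofFn]
  · rw [VComp.exponent, place_apply_of_notMem _ _ hp]
    symm
    by_contra h
    have hpS : p ∈ S := Finset.mem_image.mpr ⟨(i, p), Finsupp.mem_support_iff.mpr h, rfl⟩
    have : p ∈ Set.range e := by
      rw [Finset.range_orderEmbOfFin]; exact hpS
    obtain ⟨r, hr⟩ := this
    exact hp ⟨Fin.cast hl.symm r, hr⟩

theorem mdeg_add {l : ℕ} (d d' : (Fin l × ℕ) →₀ ℕ) : mdeg (d + d') = mdeg d + mdeg d' := by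
  funext i
  refine Finsupp.sum_add_index' (fun p => by simp) (fun p a b => ?_)
  split_ifs <;> simp

theorem mdeg_sum {l : ℕ} {ι : Type*} (s : Finset ι) (d : ι → ((Fin l × ℕ) →₀ ℕ)) :
    mdeg (∑ r ∈ s, d r) = ∑ r ∈ s, mdeg (d r) := by
  let F : ((Fin l × ℕ) →₀ ℕ) →+ (Fin l → ℕ) :=
    ⟨⟨mdeg, by funext i; simp [mdeg]⟩, mdeg_add⟩
  exact map_sum F d s

theorem mdeg_single {l : ℕ} (i : Fin l) (p a : ℕ) :
    mdeg (Finsupp.single (i, p) a) = Pi.single i a := by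
  funext i'
  rw [mdeg, Finsupp.sum_single_index (by simp), Pi.single_apply]
  simp [eq_comm]

theorem mdeg_exponent {l : ℕ} (I : VComp l) (j : Fin I.length → ℕ) :
    mdeg (I.exponent j) = I.total := by
  rw [VComp.exponent, place, mdeg_sum]
  have : ∀ r : Fin I.length,
      mdeg (∑ i, Finsupp.single (i, j r) ((I.get r).1 i)) = (I.get r).1 := by
    intro r
    rw [mdeg_sum]
    simp only [mdeg_single]
    exact Finset.univ_sum_single _
  rw [Finset.sum_congr rfl fun r _ => this r, VComp.total]
  conv_rhs => rw [← List.ofFn_get I, List.map_ofFn, List.sum_ofFn]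
  rfl

theorem degree_eq_weight_mdeg {l : ℕ} (d : (Fin l × ℕ) →₀ ℕ) : d.degree = weight (mdeg d) := by
  rw [weight]
  simp only [mdeg, Finsupp.sum]
  rw [Finset.sum_comm]
  simp [Finsupp.degree_apply]

theorem degree_exponent {l : ℕ} (I : VComp l) (j : Fin I.length → ℕ) :
    (I.exponent j).degree = weight I.total := by
  rw [degree_eq_weight_mdeg, mdeg_exponent]

theorem finite_weight_le (l N : ℕ) : {I : VComp l | weight I.total ≤ N}.Finite := by
  have hcons : ∀ (c : {n : Fin l → ℕ // n ≠ 0}) (I : VComp l),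
      weight (VComp.total (c :: I)) = weight c.1 + weight I.total := by
    intro c I
    simp [VComp.total, weight, Finset.sum_add_distrib]
  have hpos : ∀ c : {n : Fin l → ℕ // n ≠ 0}, 0 < weight c.1 := by
    intro c
    obtain ⟨i, hi⟩ := Function.ne_iff.mp c.2
    exact lt_of_lt_of_le (Nat.pos_of_ne_zero hi)
      (Finset.single_le_sum (f := c.1) (fun _ _ => Nat.zero_le _) (Finset.mem_univ i))
  have hlen : ∀ I : VComp l, I.length ≤ weight I.total := by
    intro I
    induction I with
    | nil => simp
    | cons c I ih => rw [hcons, List.length_cons]; have := hpos c; omega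
  have hmem : ∀ (I : VComp l), ∀ c ∈ I, weight c.1 ≤ weight I.total := by
    intro I
    induction I with
    | nil => simp
    | cons c I ih =>
      intro c' hc'
      rw [hcons]
      rcases List.mem_cons.mp hc' with h | h
      · subst h; omega
      · have := ih c' h; omega
  let T := {c : {n : Fin l → ℕ // n ≠ 0} // weight c.1 ≤ N}
  have hT : Finite T := by
    refine Finite.of_injective
      (fun c : T => (fun i => (⟨c.1.1 i, Nat.lt_succ_of_le ((Finset.single_le_sum (f := c.1.1)
        (fun _ _ => Nat.zero_le _) (Finset.mem_univ i)).trans c.2)⟩ : Fin (N + 1)))) ?_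
    intro c c' h
    apply Subtype.ext
    apply Subtype.ext
    funext i
    exact congrArg Fin.val (congrFun h i)
  refine ((List.finite_length_le T N).image (List.map Subtype.val)).subset ?_
  intro I hI
  have hI' : ∀ c ∈ I, weight c.1 ≤ N := fun c hc => (hmem I c hc).trans hI
  refine ⟨I.attachWith _ hI', ?_, ?_⟩
  · change (I.attachWith _ hI').length ≤ N
    rw [List.length_attachWith]
    exact (hlen I).trans hI
  · exact List.attachWith_map_subtype_val hI'

/-! ### The monomial basis -/

open Classical in
/-- The monomial quasisymmetric function `M_I = ∑_{j_1 < ⋯ < j_m} x_{j_1}^{I_1} ⋯ x_{j_m}^{I_m}`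
(each monomial of the sum arises only once). -/
def monomial {l : ℕ} (I : VComp l) : QSym l :=
  ⟨fun d => if ∃ j : Fin I.length → ℕ, StrictMono j ∧ I.exponent j = d then 1 else 0, by
    refine ⟨⟨weight I.total, fun d hd => ?_⟩, fun J j hj => ?_⟩
    · by_cases h : ∃ j : Fin I.length → ℕ, StrictMono j ∧ I.exponent j = d
      · obtain ⟨j, -, rfl⟩ := h
        exact (degree_exponent I j).le
      · exact absurd (if_neg h) hd
    · refine if_congr ⟨?_, ?_⟩ rfl rfl
      · rintro ⟨j', hj', h⟩
        obtain rfl := exponent_inj hj' hj h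
        exact ⟨_, strictMono_val _, rfl⟩
      · rintro ⟨j', hj', h⟩
        obtain rfl := exponent_inj hj' (strictMono_val _) h
        exact ⟨j, hj, rfl⟩⟩

open Classical in
theorem coeff_monomial {l : ℕ} (I : VComp l) (d : (Fin l × ℕ) →₀ ℕ) :
    MvPowerSeries.coeff d (monomial I).1 =
      if ∃ j : Fin I.length → ℕ, StrictMono j ∧ I.exponent j = d then 1 else 0 := rfl

theorem coeff_initExponent_monomial {l : ℕ} (I J : VComp l) :
    MvPowerSeries.coeff J.initExponent (monomial I).1 = Finsupp.single I (1 : ℚ) J := by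
  classical
  rw [coeff_monomial, Finsupp.single_apply]
  refine if_congr ⟨?_, ?_⟩ rfl rfl
  · rintro ⟨j, hj, h⟩
    exact exponent_inj hj (strictMono_val _) h
  · rintro rfl
    exact ⟨_, strictMono_val _, rfl⟩

theorem finite_support_coeff {l : ℕ} (f : QSym l) :
    (Function.support fun I : VComp l => MvPowerSeries.coeff I.initExponent f.1).Finite := by
  obtain ⟨N, hN⟩ := f.2.1
  refine (finite_weight_le l N).subset fun I hI => ?_
  have := hN _ hI
  rwa [VComp.initExponent, degree_exponent] at this

/-- The coefficients of a quasisymmetric function in the monomial basis. -/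
def coords (l : ℕ) : QSym l →ₗ[ℚ] (VComp l →₀ ℚ) where
  toFun f := Finsupp.ofSupportFinite
    (fun I => MvPowerSeries.coeff I.initExponent f.1) (finite_support_coeff f)
  map_add' f g := by ext I; exact map_add (MvPowerSeries.coeff I.initExponent) f.1 g.1
  map_smul' a f := by ext I; exact (MvPowerSeries.coeff I.initExponent).map_smul a f.1

theorem coords_apply {l : ℕ} (f : QSym l) (I : VComp l) :
    coords l f I = MvPowerSeries.coeff I.initExponent f.1 := rfl

theorem coords_monomial {l : ℕ} (I : VComp l) : coords l (monomial I) = Finsupp.single I 1 := by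
  ext J
  rw [coords_apply, coeff_initExponent_monomial]

theorem coords_bijective (l : ℕ) : Function.Bijective (coords l) := by
  constructor
  · rw [injective_iff_map_eq_zero]
    intro f hf
    apply Subtype.ext
    ext d
    obtain ⟨I, j, hj, rfl⟩ := exists_exponent_eq d
    rw [f.2.2 I j hj, ← coords_apply, hf]
    simp
  · intro v
    refine ⟨v.sum fun I a => a • monomial I, ?_⟩
    rw [Finsupp.sum, map_sum]
    simp only [map_smul, coords_monomial, Finsupp.smul_single, smul_eq_mul, mul_one]
    exact v.sum_single

/-- The basis `(M_I)` of `QSym l`, indexed by vector compositions. -/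
def monomialBasis (l : ℕ) : Module.Basis (VComp l) ℚ (QSym l) :=
  .ofRepr (LinearEquiv.ofBijective (coords l) (coords_bijective l))

theorem monomialBasis_apply {l : ℕ} (I : VComp l) : monomialBasis l I = monomial I := by
  apply (LinearEquiv.ofBijective (coords l) (coords_bijective l)).injective
  change (monomialBasis l).repr (monomialBasis l I) = coords l (monomial I)
  rw [Module.Basis.repr_self, coords_monomial]

/-! ### The coalgebra structure -/

/-- The coproduct `Δ M_I = ∑_{I = JK} M_J ⊗ M_K`. -/
def comulMap (l : ℕ) : QSym l →ₗ[ℚ] QSym l ⊗[ℚ] QSym l :=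
  (monomialBasis l).constr ℚ fun I =>
    ∑ r ∈ Finset.range (I.length + 1), monomial (I.take r) ⊗ₜ[ℚ] monomial (I.drop r)

/-- The counit, which is the projection onto the component of multidegree `0`. -/
def counitMap (l : ℕ) : QSym l →ₗ[ℚ] ℚ :=
  (monomialBasis l).constr ℚ fun I => if I = [] then 1 else 0

theorem comulMap_monomial {l : ℕ} (I : VComp l) : comulMap l (monomial I) =
    ∑ r ∈ Finset.range (I.length + 1), monomial (I.take r) ⊗ₜ[ℚ] monomial (I.drop r) := by
  rw [← monomialBasis_apply, comulMap, Module.Basis.constr_basis]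

theorem counitMap_monomial {l : ℕ} (I : VComp l) :
    counitMap l (monomial I) = if I = [] then 1 else 0 := by
  rw [← monomialBasis_apply, counitMap, Module.Basis.constr_basis]

instance (l : ℕ) : Coalgebra ℚ (QSym l) where
  comul := comulMap l
  counit := counitMap l
  coassoc := by
    refine (monomialBasis l).ext fun I => ?_
    simp only [monomialBasis_apply, LinearMap.comp_apply, comulMap_monomial, map_sum,
      LinearMap.rTensor_tmul, LinearMap.lTensor_tmul, TensorProduct.sum_tmul,
      TensorProduct.tmul_sum, LinearEquiv.coe_coe, TensorProduct.assoc_tmul]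
    rw [Finset.sum_sigma', Finset.sum_sigma']
    refine Finset.sum_bij' (fun x _ => ⟨x.2, x.1 - x.2⟩) (fun x _ => ⟨x.1 + x.2, x.1⟩)
      ?_ ?_ ?_ ?_ ?_
    · rintro ⟨r, s⟩ h
      simp only [Finset.mem_sigma, Finset.mem_range, List.length_take, List.length_drop] at h ⊢
      omega
    · rintro ⟨r, s⟩ h
      simp only [Finset.mem_sigma, Finset.mem_range, List.length_take, List.length_drop] at h ⊢
      omega
    · rintro ⟨r, s⟩ h
      simp only [Finset.mem_sigma, Finset.mem_range, List.length_take] at h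
      have : s + (r - s) = r := by omega
      simp [this]
    · rintro ⟨r, s⟩ h
      simp
    · rintro ⟨r, s⟩ h
      simp only [Finset.mem_sigma, Finset.mem_range, List.length_take] at h
      have h1 : min s r = s := by omega
      have h2 : s + (r - s) = r := by omega
      simp only [List.take_take, List.drop_drop, List.drop_take, h1, h2]
  rTensor_counit_comp_comul := by
    refine (monomialBasis l).ext fun I => ?_
    simp only [monomialBasis_apply, LinearMap.comp_apply, comulMap_monomial, map_sum,
      LinearMap.rTensor_tmul, counitMap_monomial]
    rw [Finset.sum_eq_single 0]
    · simp
    · intro r hr h0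
      rw [if_neg, TensorProduct.zero_tmul]
      rw [List.take_eq_nil_iff]
      rintro (h | h)
      · exact h0 h
      · subst h; simp at hr; exact h0 hr
    · simp
  lTensor_counit_comp_comul := by
    refine (monomialBasis l).ext fun I => ?_
    simp only [monomialBasis_apply, LinearMap.comp_apply, comulMap_monomial, map_sum,
      LinearMap.lTensor_tmul, counitMap_monomial]
    rw [Finset.sum_eq_single I.length]
    · simp
    · intro r hr h0
      rw [if_neg, TensorProduct.tmul_zero]
      rw [List.drop_eq_nil_iff]
      rw [Finset.mem_range] at hr
      omega
    · simp

/-! ### The multigrading -/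

theorem monomial_mem_component {l : ℕ} (I : VComp l) : monomial I ∈ component I.total := by
  classical
  intro d hd
  rw [coeff_monomial] at hd
  by_cases h : ∃ j : Fin I.length → ℕ, StrictMono j ∧ I.exponent j = d
  · obtain ⟨j, -, rfl⟩ := h
    exact mdeg_exponent I j
  · exact absurd (if_neg h) hd

theorem monomial_mem_of_total {l : ℕ} {I : VComp l} {n : Fin l → ℕ} (h : I.total = n) :
    monomial I ∈ component n := by
  subst h
  exact monomial_mem_component I

/-- The decomposition map `QSym l → ⨁ n, component n`. -/
def decomposeMap (l : ℕ) : QSym l →ₗ[ℚ] ⨁ n : Fin l → ℕ, component n :=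
  (monomialBasis l).constr ℚ fun I =>
    DirectSum.lof ℚ (Fin l → ℕ) (fun n => component n) I.total
      ⟨monomial I, monomial_mem_component I⟩

theorem eq_sum_coords {l : ℕ} (f : QSym l) :
    f = ∑ I ∈ (coords l f).support, coords l f I • monomial I := by
  apply (coords_bijective l).1
  rw [map_sum]
  simp only [map_smul, coords_monomial, Finsupp.smul_single, smul_eq_mul, mul_one]
  exact (coords l f).sum_single.symm

theorem decomposeMap_monomial {l : ℕ} {I : VComp l} {n : Fin l → ℕ} (h : I.total = n) :
    decomposeMap l (monomial I) = DirectSum.lof ℚ (Fin l → ℕ) (fun n => component n) n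
      ⟨monomial I, monomial_mem_of_total h⟩ := by
  subst h
  conv_lhs => rw [← monomialBasis_apply, decomposeMap, Module.Basis.constr_basis]

theorem decomposeMap_of_mem {l : ℕ} (n : Fin l → ℕ) (f : component n) :
    decomposeMap l f.1 = DirectSum.lof ℚ (Fin l → ℕ) (fun n => component n) n f := by
  have htot : ∀ I ∈ (coords l f.1).support, I.total = n := by
    intro I hI
    rw [← f.2 _ (Finsupp.mem_support_iff.mp hI), VComp.initExponent, mdeg_exponent]
  have hf : f = ∑ I ∈ (coords l f.1).support.attach, coords l f.1 I.1 •
      (⟨monomial I.1, monomial_mem_of_total (htot I.1 I.2)⟩ : component n) := by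
    apply Subtype.ext
    rw [AddSubmonoidClass.coe_finsetSum]
    conv_lhs => rw [eq_sum_coords f.1, ← Finset.sum_attach]
    rfl
  conv_rhs => rw [hf, map_sum]
  conv_lhs => rw [eq_sum_coords f.1, map_sum, ← Finset.sum_attach]
  refine Finset.sum_congr rfl fun I _ => ?_
  rw [map_smul, map_smul, decomposeMap_monomial (htot I.1 I.2)]

instance (l : ℕ) : DirectSum.Decomposition (component : (Fin l → ℕ) → Submodule ℚ (QSym l)) :=
  DirectSum.Decomposition.ofLinearMap _ (decomposeMap l)
    (by
      refine (monomialBasis l).ext fun I => ?_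
      rw [LinearMap.comp_apply, decomposeMap, Module.Basis.constr_basis,
        DirectSum.coeLinearMap_lof, monomialBasis_apply, LinearMap.id_apply])
    (by
      refine DirectSum.linearMap_ext _ fun n => LinearMap.ext fun f => ?_
      simp only [LinearMap.comp_apply, DirectSum.coeLinearMap_lof, LinearMap.id_apply]
      exact decomposeMap_of_mem n f)

/-! ### The universal character and the `k`-odd subalgebra -/

/-- The universal character: `ζ M_I = 1` if `I` has length `0` or `1`, else `0`. (That is,
the variables at the first position are set to `1` and all the others to `0`.) -/
def zeta (l : ℕ) : QSym l →ₗ[ℚ] ℚ :=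
  (monomialBasis l).constr ℚ fun I => if I.length ≤ 1 then 1 else 0

/-- The functional `M_I ↦ (-1)^length I`. -/
def signMap (l : ℕ) : QSym l →ₗ[ℚ] ℚ :=
  (monomialBasis l).constr ℚ fun I => (-1) ^ I.length

theorem zeta_monomial {l : ℕ} (I : VComp l) :
    zeta l (monomial I) = if I.length ≤ 1 then 1 else 0 := by
  rw [← monomialBasis_apply, zeta, Module.Basis.constr_basis]

theorem signMap_monomial {l : ℕ} (I : VComp l) : signMap l (monomial I) = (-1) ^ I.length := by
  rw [← monomialBasis_apply, signMap, Module.Basis.constr_basis]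

theorem conv_monomial {l : ℕ} (φ ψ : QSym l →ₗ[ℚ] ℚ) (I : VComp l) :
    (WithConv.toConv φ * WithConv.toConv ψ) (monomial I) =
      ∑ r ∈ Finset.range (I.length + 1), φ (monomial (I.take r)) * ψ (monomial (I.drop r)) := by
  rw [LinearMap.convMul_apply]
  change LinearMap.mul' ℚ ℚ (TensorProduct.map φ ψ (comulMap l (monomial I))) = _
  rw [comulMap_monomial, map_sum, map_sum]
  simp

theorem conv_ext {l : ℕ} {φ ψ : WithConv (QSym l →ₗ[ℚ] ℚ)}
    (h : ∀ I, φ (monomial I) = ψ (monomial I)) : φ = ψ := by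
  refine WithConv.ofConv_injective ((monomialBasis l).ext fun I => ?_)
  rw [monomialBasis_apply]
  exact h I

theorem one_monomial {l : ℕ} (I : VComp l) :
    (1 : WithConv (QSym l →ₗ[ℚ] ℚ)) (monomial I) = if I = [] then 1 else 0 := by
  rw [LinearMap.convOne_apply]
  exact counitMap_monomial I

theorem zeta_mul_signMap (l : ℕ) :
    WithConv.toConv (zeta l) * WithConv.toConv (signMap l) = 1 := by
  refine conv_ext fun I => ?_
  rw [conv_monomial, one_monomial]
  simp only [zeta_monomial, signMap_monomial]
  rcases I with _ | ⟨c, I⟩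
  · simp
  · rw [if_neg (List.cons_ne_nil c I), Finset.sum_range_succ', List.length_cons,
      Finset.sum_range_succ']
    rw [Finset.sum_eq_zero]
    · simp [pow_succ]
    · intro r hr
      rw [Finset.mem_range] at hr
      rw [if_neg, zero_mul]
      simp only [List.length_take, List.length_cons]
      omega

theorem signMap_mul_zeta (l : ℕ) :
    WithConv.toConv (signMap l) * WithConv.toConv (zeta l) = 1 := by
  refine conv_ext fun I => ?_
  rw [conv_monomial, one_monomial]
  simp only [zeta_monomial, signMap_monomial]
  rcases I with _ | ⟨c, I⟩
  · simp
  · rw [if_neg (List.cons_ne_nil c I), Finset.sum_range_succ, List.length_cons,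
      Finset.sum_range_succ]
    rw [Finset.sum_eq_zero]
    · simp [pow_succ]
    · intro r hr
      rw [Finset.mem_range] at hr
      rw [if_neg, mul_zero]
      simp only [List.length_drop, List.length_cons]
      omega

theorem isUnit_zeta (l : ℕ) : IsUnit (WithConv.toConv (zeta l)) :=
  ⟨⟨_, _, zeta_mul_signMap l, signMap_mul_zeta l⟩, rfl⟩

/-- The `k`-odd subalgebra `O^k` of `QSym l`, with respect to the universal character. -/
def kOdd {l : ℕ} (k : Fin l → ℕ∞) : Submodule ℚ (QSym l) :=
  kOddOf component k (zeta l)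

/-- The multivariate Hilbert series `∑_n dim (O^k)_n t^n`, where `(O^k)_n` consists of the
elements of `O^k` of multidegree `n`. -/
def kOddHilbertSeries {l : ℕ} (k : Fin l → ℕ∞) : MvPowerSeries (Fin l) ℚ :=
  fun n => (Module.finrank ℚ ↥(kOdd k ⊓ component (n : Fin l → ℕ)) : ℚ)

/-! ### The rational function -/

/-- The term `t_i ^ (2 ⌊(κ - b) / 2⌋ + 2)`, taken to be `0` when `κ = ∞`. The exponent is
nonnegative for `b ≤ 1`. -/
def cutTerm {l : ℕ} (i : Fin l) (κ : ℕ∞) (b : ℕ) : MvPolynomial (Fin l) ℚ :=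
  if κ = ⊤ then 0
  else MvPolynomial.X i ^ (2 * ⌊((κ.toNat : ℚ) - (b : ℚ)) / 2⌋ + 2).toNat

/-- `∏ (1 - t_i^2)`. -/
def hilbertNum (l : ℕ) : MvPolynomial (Fin l) ℚ :=
  ∏ i, (1 - MvPolynomial.X i ^ 2)

/-- `∏ (1 - t_i^2) - ∏ (1 + t_i) + ∑_b ∏ t_i^{b_i} (1 - t_i^{2⌊(k_i - b_i)/2⌋ + 2})`, with `b`
ranging over the 0/1 vectors of even weight. -/
def hilbertDen {l : ℕ} (k : Fin l → ℕ∞) : MvPolynomial (Fin l) ℚ :=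
  ∏ i, (1 - MvPolynomial.X i ^ 2) - ∏ i, (1 + MvPolynomial.X i) +
    ∑ b : Fin l → Fin 2 with Even (∑ i, (b i : ℕ)),
      ∏ i, MvPolynomial.X i ^ (b i : ℕ) * (1 - cutTerm i (k i) (b i))

end LevelQSym

end

open scoped TensorProduct DirectSum

noncomputable section

namespace LevelQSym


/-! ### The convolution algebra of linear functionals -/

/-! Work in the convolution algebra of functionals on `QSym l`. It is dual to deconcatenation, and
products of the homogeneous components ζ_n (n ≠ 0) of ζ are dual to the monomial basis. Put X = ζ̄ -
ζ⁻¹. On a one-column monomial of weight w, X takes the value (-1)^w + 1. Hence in even weight the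
component X_n/2 can replace the generator ζ_n, while in odd weight X_n has no linear term.

Make this replacement exactly when n ≤ k and |n| is even. The products of the new generators are
unitriangular with respect to composition length (`genProd_monomial_of_length_le`), so they have a
dual basis of `QSym l`, on which the coproduct is again deconcatenation (`comul_dualBasis`). Then
O^k is the span of the dual basis elements whose index has no eliminated column
(`kOdd_eq_reducedSpan`):

An admissible subcoalgebra is killed by X_n for every n ≤ k, hence by the two-sided ideal that these
generate, in particular by every product containing an eliminated generator (`le_reducedSpan`).
Conversely, the span is a graded subcoalgebra, and X must be shown to vanish on its part of degrees
n ≤ k. In even degree this is duality. In odd degree it follows by induction from the syzygy X ζ ζ̄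
= ζ̄ X̄ ζ̄, which modulo shorter factors reads X = X̄ = -X (`defect_dualBasis`).

The dimension of the component of degree n is therefore the number of sequences of surviving degrees
with sum n, so the Hilbert series is 1/(1 - S), with S the generating function of those degrees
(`one_sub_survivingSeries_mul`). Here S is the series of all degrees minus that of the eliminated
ones (0 included in both). Splitting the latter by the parities of the coordinates gives products of
finite or infinite geometric series, and multiplication by ∏ (1 - t_i²) clears the denominators
(`hilbertNum_mul_one_sub`). -/

theorem convInv_zeta (l : ℕ) : convInv (zeta l) = signMap l := by
  have h : Ring.inverse (WithConv.toConv (zeta l)) = WithConv.toConv (signMap l) := by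
    have := (Ring.eq_mul_inverse_iff_mul_eq (WithConv.toConv (signMap l)) 1 _ (isUnit_zeta l)).mpr
      (signMap_mul_zeta l)
    rw [this, one_mul]
  rw [convInv, h]

theorem homProj_monomial {l : ℕ} (n : Fin l → ℕ) (I : VComp l) :
    homProj component n (monomial I) = if I.total = n then monomial I else 0 := by
  rw [homProj_apply]
  split_ifs with h
  · exact DirectSum.decompose_of_mem_same component (monomial_mem_of_total h)
  · exact DirectSum.decompose_of_mem_ne component (monomial_mem_component I) h

theorem bar_of_mem {l : ℕ} (φ : QSym l →ₗ[ℚ] ℚ) {n : Fin l → ℕ} {h : QSym l}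
    (hh : h ∈ component n) : bar component φ h = (-1) ^ weight n * φ h := by
  have h1 : DirectSum.decomposeLinearEquiv component h =
      DirectSum.lof ℚ (Fin l → ℕ) (fun n => component n) n ⟨h, hh⟩ :=
    DirectSum.decompose_of_mem component hh
  rw [bar, LinearMap.comp_apply, LinearEquiv.coe_coe, h1, DirectSum.toModule_lof]
  rfl

theorem bar_monomial {l : ℕ} (φ : QSym l →ₗ[ℚ] ℚ) (I : VComp l) :
    bar component φ (monomial I) = (-1) ^ weight I.total * φ (monomial I) :=
  bar_of_mem φ (monomial_mem_component I)

theorem VComp.total_append {l : ℕ} (I J : VComp l) :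
    VComp.total (I ++ J) = I.total + J.total := by
  simp [VComp.total]

theorem VComp.total_cons {l : ℕ} (c : {n : Fin l → ℕ // n ≠ 0}) (I : VComp l) :
    VComp.total (c :: I) = c.1 + I.total := by
  simp [VComp.total]

theorem VComp.total_nil {l : ℕ} : VComp.total ([] : VComp l) = 0 := rfl

theorem VComp.total_take_add_drop {l : ℕ} (I : VComp l) (r : ℕ) :
    VComp.total (I.take r) + VComp.total (I.drop r) = I.total := by
  rw [← VComp.total_append, List.take_append_drop]

theorem weight_add {l : ℕ} (m n : Fin l → ℕ) : weight (m + n) = weight m + weight n := by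
  simp [weight, Finset.sum_add_distrib]

/-- The coproduct preserves multidegree and (-1)^|n| is multiplicative in n, so the bar operation is
an algebra endomorphism for convolution. -/
theorem bar_mul {l : ℕ} (φ ψ : QSym l →ₗ[ℚ] ℚ) :
    WithConv.toConv (bar component (WithConv.toConv φ * WithConv.toConv ψ).ofConv) =
      WithConv.toConv (bar component φ) * WithConv.toConv (bar component ψ) := by
  refine conv_ext fun I => ?_
  rw [conv_monomial]
  change bar component _ (monomial I) = _
  rw [bar_monomial, conv_monomial, Finset.mul_sum]
  refine Finset.sum_congr rfl fun r _ => ?_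
  rw [bar_monomial, bar_monomial, ← VComp.total_take_add_drop I r, weight_add, pow_add]
  ring

theorem bar_one {l : ℕ} :
    WithConv.toConv (bar component (1 : WithConv (QSym l →ₗ[ℚ] ℚ)).ofConv) = 1 := by
  refine conv_ext fun I => ?_
  change bar component _ (monomial I) = _
  rw [bar_monomial, one_monomial]
  split_ifs with h
  · subst h; simp [VComp.total_nil, weight]
  · simp

/-- The functional `ζ̄ - ζ⁻¹`. -/
def defect (l : ℕ) : QSym l →ₗ[ℚ] ℚ := bar component (zeta l) - convInv (zeta l)

theorem bar_sub {l : ℕ} (φ ψ : QSym l →ₗ[ℚ] ℚ) :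
    bar component (φ - ψ) = bar component φ - bar component ψ := by
  refine (monomialBasis l).ext fun I => ?_
  simp only [monomialBasis_apply, LinearMap.sub_apply, bar_monomial, mul_sub]

theorem bar_bar {l : ℕ} (φ : QSym l →ₗ[ℚ] ℚ) : bar component (bar component φ) = φ := by
  refine (monomialBasis l).ext fun I => ?_
  simp only [monomialBasis_apply, bar_monomial]
  rw [← mul_assoc, ← mul_pow]; simp

/-- The syzygy `X ζ ζ̄ = ζ̄ X̄ ζ̄` for `X = ζ̄ - ζ⁻¹`. -/
theorem defect_syzygy (l : ℕ) :
    WithConv.toConv (defect l) * (WithConv.toConv (zeta l) *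
      WithConv.toConv (bar component (zeta l))) =
    WithConv.toConv (bar component (zeta l)) * (WithConv.toConv (bar component (defect l)) *
      WithConv.toConv (bar component (zeta l))) := by
  -- Both sides of the syzygy expand to ζ̄ ζ ζ̄ - ζ̄: the left by ζ⁻¹ ζ = 1, the right by the bar of
  -- that identity.
  have h1 : WithConv.toConv (bar component (signMap l)) *
      WithConv.toConv (bar component (zeta l)) = 1 := by
    rw [← bar_mul, signMap_mul_zeta, bar_one]
  have h2 : WithConv.toConv (signMap l) * (WithConv.toConv (zeta l) *
      WithConv.toConv (bar component (zeta l))) = WithConv.toConv (bar component (zeta l)) := by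
    rw [← mul_assoc, signMap_mul_zeta, one_mul]
  rw [defect, convInv_zeta, bar_sub, bar_bar, WithConv.toConv_sub, WithConv.toConv_sub, sub_mul,
    sub_mul, h1, h2, mul_sub, mul_one, ← mul_assoc]

theorem defect_monomial {l : ℕ} (I : VComp l) : defect l (monomial I) =
    (-1) ^ weight I.total * (if I.length ≤ 1 then 1 else 0) - (-1) ^ I.length := by
  rw [defect, convInv_zeta, LinearMap.sub_apply, bar_monomial, zeta_monomial, signMap_monomial]

/-! ### A new system of generators of the dual algebra -/

/-- The multidegrees in which the relation `ζ̄ = ζ⁻¹` eliminates a generator. -/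
def Eliminated {l : ℕ} (k : Fin l → ℕ∞) (n : Fin l → ℕ) : Prop :=
  BoundedBy k n ∧ Even (weight n)

open Classical in
/-- The generators of the dual algebra: half the component of `ζ̄ - ζ⁻¹` in the eliminated
multidegrees, and the component of `ζ` in the others. -/
def gen {l : ℕ} (k : Fin l → ℕ∞) (n : Fin l → ℕ) : QSym l →ₗ[ℚ] ℚ :=
  (if Eliminated k n then (1 / 2 : ℚ) • defect l else zeta l) ∘ₗ homProj component n

open Classical in
theorem gen_monomial {l : ℕ} (k : Fin l → ℕ∞) (n : Fin l → ℕ) (I : VComp l) :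
    gen k n (monomial I) = if I.total = n then
      (if Eliminated k n then 1 / 2 * defect l (monomial I) else zeta l (monomial I)) else 0 := by
  rw [gen, LinearMap.comp_apply, homProj_monomial]
  split_ifs <;> simp

theorem gen_nil {l : ℕ} (k : Fin l → ℕ∞) {n : Fin l → ℕ} (hn : n ≠ 0) :
    gen k n (monomial ([] : VComp l)) = 0 := by
  classical
  rw [gen_monomial, if_neg]
  exact fun h => hn h.symm

theorem gen_singleton {l : ℕ} (k : Fin l → ℕ∞) (n : Fin l → ℕ) (c : {n : Fin l → ℕ // n ≠ 0}) :
    gen k n (monomial [c]) = if c.1 = n then 1 else 0 := by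
  classical
  have ht : VComp.total [c] = c.1 := by simp [VComp.total]
  rw [gen_monomial, ht]
  split_ifs with h h2
  -- In even weight the defect takes the value 1 - (-1) = 2 on a single column; the factor 1/2 in
  -- `gen` normalises this.
  · rw [defect_monomial, ht, h, h2.2.neg_one_pow]; norm_num
  · rw [zeta_monomial]; simp
  · rfl

/-- The products of the generators. -/
def genProd {l : ℕ} (k : Fin l → ℕ∞) (I : VComp l) : WithConv (QSym l →ₗ[ℚ] ℚ) :=
  (I.map fun c => WithConv.toConv (gen k c.1)).prod

theorem genProd_append {l : ℕ} (k : Fin l → ℕ∞) (I J : VComp l) :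
    genProd k (I ++ J) = genProd k I * genProd k J := by
  simp [genProd]

theorem genProd_nil {l : ℕ} (k : Fin l → ℕ∞) : genProd k [] = 1 := rfl

theorem genProd_cons {l : ℕ} (k : Fin l → ℕ∞) (c : {n : Fin l → ℕ // n ≠ 0}) (I : VComp l) :
    genProd k (c :: I) = WithConv.toConv (gen k c.1) * genProd k I := by
  simp [genProd]

theorem genProd_cons_monomial {l : ℕ} (k : Fin l → ℕ∞) (c : {n : Fin l → ℕ // n ≠ 0})
    (I J : VComp l) : genProd k (c :: I) (monomial J) = ∑ r ∈ Finset.range (J.length + 1),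
      gen k c.1 (monomial (J.take r)) * genProd k I (monomial (J.drop r)) := by
  rw [genProd_cons]
  exact conv_monomial _ _ _

theorem genProd_monomial_of_total_ne {l : ℕ} (k : Fin l → ℕ∞) (I J : VComp l)
    (h : J.total ≠ I.total) : genProd k I (monomial J) = 0 := by
  classical
  induction I generalizing J with
  | nil =>
    rw [genProd_nil, one_monomial, if_neg]
    rintro rfl
    exact h rfl
  | cons c I ih =>
    rw [genProd_cons_monomial]
    refine Finset.sum_eq_zero fun r _ => ?_
    by_cases h1 : VComp.total (J.take r) = c.1
    · rw [ih, mul_zero]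
      intro h2
      apply h
      rw [← VComp.total_take_add_drop J r, h1, h2, VComp.total_cons]
    · rw [gen_monomial, if_neg h1, zero_mul]

/-- Every generator vanishes on the empty monomial, so a product of m generators only sees cuts of
`J` into m nonempty blocks. There is none if `J` is shorter than m; if the lengths agree, all blocks
are single columns and `gen_singleton` applies. This is the triangularity behind the dual basis. -/
theorem genProd_monomial_of_length_le {l : ℕ} (k : Fin l → ℕ∞) (I J : VComp l)
    (h : J.length ≤ I.length) :
    genProd k I (monomial J) = Finsupp.single J (1 : ℚ) I := by
  classical
  rw [Finsupp.single_apply]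
  induction I generalizing J with
  | nil => rw [genProd_nil, one_monomial]
  | cons c I ih =>
    rw [genProd_cons_monomial]
    rcases J with _ | ⟨d, J⟩
    · simp [gen_nil k c.2]
    · rw [List.length_cons, List.length_cons] at h
      -- Isolate the first blocks of length 0 and 1. A first block of length at least 2 leaves a
      -- tail strictly shorter than `I`, on which the induction hypothesis gives 0.
      rw [Finset.sum_range_succ', List.length_cons, Finset.sum_range_succ']
      rw [Finset.sum_eq_zero]
      · rw [List.take_zero, gen_nil k c.2]
        simp only [zero_add, List.take_succ_cons, List.take_zero, List.drop_succ_cons,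
          List.drop_zero, gen_singleton, zero_mul, add_zero]
        rw [ih J (by omega)]
        by_cases h1 : d = c <;> by_cases h2 : J = I <;> simp [h1, h2]
        exact fun h => absurd (Subtype.ext h) h1
      · intro r hr
        rw [Finset.mem_range] at hr
        have hl : (J.drop (r + 1)).length < I.length := by
          rw [List.length_drop]; omega
        rw [List.drop_succ_cons, ih _ hl.le, if_neg, mul_zero]
        rintro h1
        rw [h1] at hl
        exact lt_irrefl _ hl

/-! ### The dual basis -/

theorem genProd_eq_sum {l : ℕ} (k : Fin l → ℕ∞) (I : VComp l) (h : QSym l) :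
    genProd k I h = ∑ J ∈ (coords l h).support, coords l h J * genProd k I (monomial J) := by
  conv_lhs => rw [eq_sum_coords h]
  rw [map_sum]
  simp

theorem finite_support_genProd {l : ℕ} (k : Fin l → ℕ∞) (h : QSym l) :
    (Function.support fun I : VComp l => genProd k I h).Finite := by
  refine (Set.Finite.biUnion (coords l h).support.finite_toSet
    (fun J _ => finite_weight_le l (weight J.total))).subset fun I hI => ?_
  by_contra hcon
  refine hI ?_
  change genProd k I h = 0
  rw [genProd_eq_sum]
  refine Finset.sum_eq_zero fun J hJ => ?_
  rw [genProd_monomial_of_total_ne, mul_zero]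
  intro he
  refine hcon (Set.mem_biUnion hJ ?_)
  change weight I.total ≤ weight J.total
  rw [he]

/-- The map sending a quasisymmetric function to its values on the products of generators. -/
def genCoords {l : ℕ} (k : Fin l → ℕ∞) : QSym l →ₗ[ℚ] (VComp l →₀ ℚ) where
  toFun h := Finsupp.ofSupportFinite (fun I => genProd k I h) (finite_support_genProd k h)
  map_add' f g := by ext I; exact map_add (genProd k I).ofConv f g
  map_smul' a f := by ext I; exact (genProd k I).ofConv.map_smul a f

theorem genCoords_apply {l : ℕ} (k : Fin l → ℕ∞) (h : QSym l) (I : VComp l) :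
    genCoords k h I = genProd k I h := rfl

theorem genCoords_injective {l : ℕ} (k : Fin l → ℕ∞) : Function.Injective (genCoords k) := by
  rw [injective_iff_map_eq_zero]
  intro h hh
  by_contra hne
  have hs : (coords l h).support.Nonempty := by
    rw [Finsupp.support_nonempty_iff]
    exact fun h0 => hne ((coords_bijective l).1 (by rw [h0, map_zero]))
  -- By triangularity, the product indexed by a longest composition in the support reads off exactly
  -- its coefficient.
  obtain ⟨J, hJ, hmax⟩ := Finset.exists_max_image _ List.length hs
  have h1 : genProd k J h = 0 := by rw [← genCoords_apply, hh]; rfl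
  rw [genProd_eq_sum, Finset.sum_eq_single J] at h1
  · rw [genProd_monomial_of_length_le k J J le_rfl, Finsupp.single_eq_same, mul_one] at h1
    exact Finsupp.mem_support_iff.mp hJ h1
  · intro J' hJ' hne'
    rw [genProd_monomial_of_length_le k J J' (hmax J' hJ'), Finsupp.single_eq_of_ne, mul_zero]
    exact hne'.symm
  · exact fun h2 => absurd hJ h2

theorem genCoords_surjective {l : ℕ} (k : Fin l → ℕ∞) : Function.Surjective (genCoords k) := by
  have key : ∀ (N : ℕ) (J : VComp l), J.length ≤ N →
      Finsupp.single J (1 : ℚ) ∈ LinearMap.range (genCoords k) := by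
    intro N
    induction N using Nat.strong_induction_on with
    | _ N ih =>
    intro J hJ
    -- The error term is supported on compositions strictly shorter than `J`, which the induction
    -- covers.
    have h1 : genCoords k (monomial J) - Finsupp.single J 1 ∈ LinearMap.range (genCoords k) := by
      rw [← Finsupp.sum_single (genCoords k (monomial J) - Finsupp.single J 1)]
      refine Submodule.sum_mem _ fun I hI => ?_
      have hlt : I.length < J.length := by
        by_contra hlt
        rw [Finsupp.mem_support_iff, Finsupp.sub_apply, genCoords_apply,
          genProd_monomial_of_length_le k I J (not_lt.mp hlt), sub_self] at hI
        exact hI rfl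
      have := ih I.length (by omega) I le_rfl
      rw [← mul_one ((_ : VComp l →₀ ℚ) I), ← smul_eq_mul, ← Finsupp.smul_single]
      exact Submodule.smul_mem _ _ this
    have h2 := Submodule.sub_mem _ (LinearMap.mem_range_self (genCoords k) (monomial J)) h1
    rwa [sub_sub_cancel] at h2
  intro v
  rw [← LinearMap.mem_range, ← v.sum_single]
  refine Submodule.sum_mem _ fun I _ => ?_
  rw [← mul_one (v I), ← smul_eq_mul, ← Finsupp.smul_single]
  exact Submodule.smul_mem _ _ (key I.length I le_rfl)

/-- The basis of `QSym l` dual to the products of the generators. -/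
def dualBasis {l : ℕ} (k : Fin l → ℕ∞) : Module.Basis (VComp l) ℚ (QSym l) :=
  .ofRepr (LinearEquiv.ofBijective (genCoords k) ⟨genCoords_injective k, genCoords_surjective k⟩)

theorem dualBasis_repr {l : ℕ} (k : Fin l → ℕ∞) (h : QSym l) (I : VComp l) :
    (dualBasis k).repr h I = genProd k I h := rfl

theorem genProd_dualBasis {l : ℕ} (k : Fin l → ℕ∞) (I J : VComp l) :
    genProd k I (dualBasis k J) = Finsupp.single J (1 : ℚ) I := by
  rw [← dualBasis_repr, Module.Basis.repr_self]

theorem dualBasis_nil {l : ℕ} (k : Fin l → ℕ∞) : dualBasis k [] = monomial [] := by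
  refine (dualBasis k).repr.injective ?_
  ext I
  rw [Module.Basis.repr_self, dualBasis_repr, genProd_monomial_of_length_le k I [] (Nat.zero_le _)]

/-- The products of generators multiply by concatenation of their indices (`genProd_append`), and
the transpose of concatenation is deconcatenation. -/
theorem comul_dualBasis {l : ℕ} (k : Fin l → ℕ∞) (I : VComp l) :
    Coalgebra.comul (R := ℚ) (dualBasis k I) = ∑ r ∈ Finset.range (I.length + 1),
      dualBasis k (I.take r) ⊗ₜ[ℚ] dualBasis k (I.drop r) := by
  classical
  -- The coordinates of a tensor are its values under pairs of products of generators; on a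
  -- coproduct such a value is a convolution product.
  have hrepr : ∀ (t : QSym l ⊗[ℚ] QSym l) (P Q : VComp l),
      ((dualBasis k).tensorProduct (dualBasis k)).repr t (P, Q) =
        LinearMap.mul' ℚ ℚ (TensorProduct.map (genProd k P).ofConv (genProd k Q).ofConv t) := by
    intro t P Q
    induction t with
    | zero => simp
    | add x y hx hy => rw [map_add, Finsupp.add_apply, hx, hy, map_add, map_add]
    | tmul x y =>
      rw [Module.Basis.tensorProduct_repr_tmul_apply, dualBasis_repr, dualBasis_repr]
      simp [mul_comm]
  refine ((dualBasis k).tensorProduct (dualBasis k)).repr.injective ?_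
  ext ⟨P, Q⟩
  rw [hrepr, ← LinearMap.convMul_apply, ← genProd_append, genProd_dualBasis, map_sum,
    Finsupp.finsetSum_apply]
  simp only [Module.Basis.tensorProduct_repr_tmul_apply, Module.Basis.repr_self, smul_eq_mul,
    Finsupp.single_apply]
  by_cases h : I = P ++ Q
  · subst h
    rw [Finset.sum_eq_single P.length]
    · simp
    · intro r hr hne
      rw [mul_comm, if_neg (fun h => hne ?_), zero_mul]
      rw [← h, List.length_take]
      rw [Finset.mem_range] at hr
      omega
    · intro h; simp at h
  · rw [if_neg h, eq_comm]
    refine Finset.sum_eq_zero fun r _ => ?_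
    by_cases h1 : I.take r = P
    · rw [if_neg, zero_mul]
      intro h2
      exact h (by rw [← h1, ← h2, List.take_append_drop])
    · rw [if_neg h1, mul_zero]

theorem conv_dualBasis {l : ℕ} (k : Fin l → ℕ∞) (φ ψ : WithConv (QSym l →ₗ[ℚ] ℚ)) (I : VComp l) :
    (φ * ψ) (dualBasis k I) = ∑ r ∈ Finset.range (I.length + 1),
      φ (dualBasis k (I.take r)) * ψ (dualBasis k (I.drop r)) := by
  rw [LinearMap.convMul_apply]
  change LinearMap.mul' ℚ ℚ (TensorProduct.map _ _ (Coalgebra.comul (R := ℚ) (dualBasis k I))) = _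
  rw [comul_dualBasis, map_sum, map_sum]
  simp


/-! ### The `k`-odd subalgebra in the dual basis -/

theorem genProd_homProj {l : ℕ} (k : Fin l → ℕ∞) (I : VComp l) (n : Fin l → ℕ) (h : QSym l) :
    genProd k I (homProj component n h) = if I.total = n then genProd k I h else 0 := by
  have : (genProd k I).ofConv ∘ₗ homProj component n =
      (if I.total = n then (genProd k I).ofConv else 0) := by
    refine (monomialBasis l).ext fun J => ?_
    rw [monomialBasis_apply, LinearMap.comp_apply, homProj_monomial]
    by_cases h1 : J.total = n
    · rw [if_pos h1]
      split_ifs with h2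
      · rfl
      · exact genProd_monomial_of_total_ne k I J fun h3 => h2 (h3.symm.trans h1)
    · rw [if_neg h1, map_zero]
      split_ifs with h2
      · exact (genProd_monomial_of_total_ne k I J fun h3 => h1 (h3.trans h2)).symm
      · rfl
  change ((genProd k I).ofConv ∘ₗ homProj component n) h = _
  rw [this]
  split_ifs <;> rfl

theorem homProj_of_mem {l : ℕ} {n : Fin l → ℕ} {h : QSym l} (hh : h ∈ component n) :
    homProj component n h = h :=
  DirectSum.decompose_of_mem_same component hh

theorem homProj_mem {l : ℕ} (n : Fin l → ℕ) (h : QSym l) :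
    homProj component n h ∈ component n :=
  (DirectSum.decompose component h n).2

theorem mem_component_iff {l : ℕ} (k : Fin l → ℕ∞) (n : Fin l → ℕ) (h : QSym l) :
    h ∈ component n ↔ ∀ I, genProd k I h ≠ 0 → I.total = n := by
  constructor
  · intro hh I hI
    by_contra hne
    rw [← homProj_of_mem hh, genProd_homProj, if_neg hne] at hI
    exact hI rfl
  · intro H
    have : homProj component n h = h := by
      refine (dualBasis k).repr.injective ?_
      ext I
      rw [dualBasis_repr, dualBasis_repr, genProd_homProj]
      by_cases h1 : genProd k I h = 0
      · rw [h1, ite_self]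
      · rw [if_pos (H I h1)]
    rw [← this]
    exact homProj_mem n h

theorem dualBasis_mem_component {l : ℕ} (k : Fin l → ℕ∞) (I : VComp l) :
    dualBasis k I ∈ component I.total := by
  rw [mem_component_iff k]
  intro J hJ
  rw [genProd_dualBasis] at hJ
  by_contra hne
  refine hJ (Finsupp.single_eq_of_ne ?_)
  rintro rfl
  exact hne rfl

/-- Vector compositions none of whose columns is an eliminated multidegree. -/
def Reduced {l : ℕ} (k : Fin l → ℕ∞) (I : VComp l) : Prop := ∀ c ∈ I, ¬ Eliminated k c.1

theorem Reduced.take {l : ℕ} {k : Fin l → ℕ∞} {I : VComp l} (h : Reduced k I) (r : ℕ) :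
    Reduced k (I.take r) := fun c hc => h c (List.mem_of_mem_take hc)

theorem Reduced.drop {l : ℕ} {k : Fin l → ℕ∞} {I : VComp l} (h : Reduced k I) (r : ℕ) :
    Reduced k (I.drop r) := fun c hc => h c (List.mem_of_mem_drop hc)

/-- The span of the elements of the dual basis with reduced index. -/
def reducedSpan {l : ℕ} (k : Fin l → ℕ∞) : Submodule ℚ (QSym l) :=
  Submodule.span ℚ (dualBasis k '' {I | Reduced k I})

theorem mem_reducedSpan_iff {l : ℕ} (k : Fin l → ℕ∞) (h : QSym l) :
    h ∈ reducedSpan k ↔ ∀ I, genProd k I h ≠ 0 → Reduced k I := by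
  rw [reducedSpan, Module.Basis.mem_span_image]
  constructor
  · intro H I hI
    exact H (Finsupp.mem_support_iff.mpr hI)
  · intro H I hI
    exact H I (Finsupp.mem_support_iff.mp hI)

theorem dualBasis_mem_reducedSpan {l : ℕ} {k : Fin l → ℕ∞} {I : VComp l} (h : Reduced k I) :
    dualBasis k I ∈ reducedSpan k := Submodule.subset_span ⟨I, h, rfl⟩

/-- Prefixes and suffixes of reduced compositions are reduced, so deconcatenation stays inside the
span; homogeneity holds because the dual basis is homogeneous. -/
theorem isGradedSubcoalgebra_reducedSpan {l : ℕ} (k : Fin l → ℕ∞) :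
    IsGradedSubcoalgebra component (reducedSpan k) where
  homogeneous n h hh := by
    rw [mem_reducedSpan_iff] at hh
    change homProj component n h ∈ _
    rw [mem_reducedSpan_iff]
    intro I hI
    rw [genProd_homProj] at hI
    refine hh I fun h0 => hI ?_
    rw [h0, ite_self]
  comul_mem := by
    have : reducedSpan k ≤ (LinearMap.range (TensorProduct.map
        (reducedSpan k).subtype (reducedSpan k).subtype)).comap Coalgebra.comul := by
      refine Submodule.span_le.mpr ?_
      rintro _ ⟨I, hI, rfl⟩
      rw [SetLike.mem_coe, Submodule.mem_comap, comul_dualBasis]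
      refine Submodule.sum_mem _ fun r _ => ?_
      exact ⟨(⟨_, dualBasis_mem_reducedSpan (hI.take r)⟩ : reducedSpan k) ⊗ₜ[ℚ]
        (⟨_, dualBasis_mem_reducedSpan (hI.drop r)⟩ : reducedSpan k), by simp⟩
    exact fun h hh => this hh

/-! ### Vanishing of ζ̄ - ζ⁻¹ on reduced elements of bounded degree -/

theorem BoundedBy.of_add_left {l : ℕ} {k : Fin l → ℕ∞} {m n : Fin l → ℕ}
    (h : BoundedBy k (m + n)) : BoundedBy k m :=
  fun i => le_trans (by simp) (h i)

theorem BoundedBy.of_add_right {l : ℕ} {k : Fin l → ℕ∞} {m n : Fin l → ℕ}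
    (h : BoundedBy k (m + n)) : BoundedBy k n :=
  fun i => le_trans (by simp) (h i)

theorem defect_nil (l : ℕ) : defect l (monomial []) = 0 := by
  simp [defect_monomial, VComp.total_nil, weight]

theorem genProd_singleton {l : ℕ} (k : Fin l → ℕ∞) (c : {n : Fin l → ℕ // n ≠ 0}) :
    genProd k [c] = WithConv.toConv (gen k c.1) := by
  rw [genProd_cons, genProd_nil, mul_one]

theorem genProd_singleton_of_eliminated {l : ℕ} (k : Fin l → ℕ∞) (c : {n : Fin l → ℕ // n ≠ 0})
    (hc : Eliminated k c.1) (h : QSym l) :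
    genProd k [c] h = 1 / 2 * defect l (homProj component c.1 h) := by
  rw [genProd_singleton]
  change gen k c.1 h = _
  rw [gen, if_pos hc]
  rfl

/-- A functional vanishing on the elements of the dual basis indexed by the proper prefixes of `I`
can be multiplied on the right by `ψ` without changing its value at `I`, up to `ψ 1`. -/
theorem conv_dualBasis_of_take {l : ℕ} (k : Fin l → ℕ∞) {φ : WithConv (QSym l →ₗ[ℚ] ℚ)}
    (ψ : WithConv (QSym l →ₗ[ℚ] ℚ)) (I : VComp l)
    (h : ∀ r < I.length, φ (dualBasis k (I.take r)) = 0) :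
    (φ * ψ) (dualBasis k I) = φ (dualBasis k I) * ψ (monomial []) := by
  rw [conv_dualBasis, Finset.sum_range_succ, Finset.sum_eq_zero, List.take_length,
    List.drop_length, dualBasis_nil, zero_add]
  intro r hr
  rw [h r (Finset.mem_range.mp hr), zero_mul]

theorem conv_dualBasis_of_drop {l : ℕ} (k : Fin l → ℕ∞) (φ : WithConv (QSym l →ₗ[ℚ] ℚ))
    {ψ : WithConv (QSym l →ₗ[ℚ] ℚ)} (I : VComp l)
    (h : ∀ r, 0 < r → r ≤ I.length → ψ (dualBasis k (I.drop r)) = 0) :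
    (φ * ψ) (dualBasis k I) = φ (monomial []) * ψ (dualBasis k I) := by
  rw [conv_dualBasis, Finset.sum_range_succ', Finset.sum_eq_zero, List.take_zero,
    List.drop_zero, dualBasis_nil, zero_add]
  intro r hr
  rw [h (r + 1) (Nat.succ_pos r) (Finset.mem_range.mp hr), mul_zero]

/-- Only the even relations were built into the generators; this shows that the odd relations in
degrees bounded by `k` follow from them, by induction on the length of `I`. -/
theorem defect_dualBasis {l : ℕ} (k : Fin l → ℕ∞) (I : VComp l) (hI : Reduced k I)
    (hk : BoundedBy k I.total) : defect l (dualBasis k I) = 0 := by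
  induction hN : I.length using Nat.strong_induction_on generalizing I with
  | _ N ih =>
  subst hN
  by_cases h0 : I.total = 0
  · have : I = [] := by
      rcases I with _ | ⟨c, I⟩
      · rfl
      · rw [VComp.total_cons] at h0
        refine absurd ?_ c.2
        funext i
        have := congrFun h0 i
        simp only [Pi.add_apply, Pi.zero_apply] at this ⊢
        omega
    rw [this, dualBasis_nil, defect_nil]
  have hz : zeta l (monomial []) = 1 := by simp [zeta_monomial]
  have hbz : bar component (zeta l) (monomial []) = 1 := by
    rw [bar_monomial, hz]; simp [VComp.total_nil, weight]
  rcases Nat.even_or_odd (weight I.total) with he | ho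
  -- Even weight: half the defect in this degree is itself a generator, so by duality it could be
  -- nonzero only if `I` were the single eliminated column `I.total`, which reducedness excludes.
  · have h1 := genProd_singleton_of_eliminated k ⟨I.total, h0⟩ ⟨hk, he⟩ (dualBasis k I)
    rw [genProd_dualBasis, homProj_of_mem (dualBasis_mem_component k I),
      Finsupp.single_eq_of_ne] at h1
    · linarith
    · intro h2
      have h3 : (⟨I.total, h0⟩ : {n : Fin l → ℕ // n ≠ 0}) ∈ I := by
        have h4 := List.mem_singleton_self (⟨I.total, h0⟩ : {n : Fin l → ℕ // n ≠ 0})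
        exact Eq.mp (congrArg (fun J : VComp l => _ ∈ J) h2) h4
      exact hI _ h3 ⟨hk, he⟩
  · have hbar : ∀ J, defect l (dualBasis k J) = 0 →
        bar component (defect l) (dualBasis k J) = 0 := by
      intro J hJ
      rw [bar_of_mem _ (dualBasis_mem_component k J), hJ, mul_zero]
    -- Proper contiguous factors of `I` inherit reducedness and the bound by `k`, so the induction
    -- hypothesis applies to them. In the syzygy evaluated at `I`, only the terms where X or X̄
    -- receives all of `I` survive.
    have hfac : ∀ r s, (List.take s (I.drop r)).length < I.length →
        defect l (dualBasis k (List.take s (I.drop r))) = 0 := by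
      intro r s hr
      refine ih _ hr _ ((hI.drop r).take s) ?_ rfl
      rw [← VComp.total_take_add_drop I r] at hk
      have hk' := hk.of_add_right
      rw [← VComp.total_take_add_drop (I.drop r) s] at hk'
      exact hk'.of_add_left
    have htake : ∀ r < I.length, defect l (dualBasis k (I.take r)) = 0 := fun r hr =>
      hfac 0 r (by rw [List.drop_zero, List.length_take]; omega)
    have h1 := conv_dualBasis_of_take k (φ := WithConv.toConv (defect l))
      (WithConv.toConv (zeta l) * WithConv.toConv (bar component (zeta l))) I htake
    have h2 := conv_dualBasis_of_take k (φ := WithConv.toConv (bar component (defect l)))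
      (WithConv.toConv (bar component (zeta l))) I fun r hr => hbar _ (htake r hr)
    have h3 := conv_dualBasis_of_drop k (WithConv.toConv (bar component (zeta l)))
      (ψ := WithConv.toConv (bar component (defect l)) *
        WithConv.toConv (bar component (zeta l))) I (by
      intro r hr hr'
      have hdrop := hfac r I.length (by rw [List.length_take, List.length_drop]; omega)
      rw [List.take_of_length_le (by rw [List.length_drop]; omega)] at hdrop
      rw [conv_dualBasis_of_take]
      · change bar component (defect l) (dualBasis k (I.drop r)) * _ = 0
        rw [hbar _ hdrop, zero_mul]
      · exact fun s hs => hbar _ (hfac r s (by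
          rw [List.length_drop] at hs; rw [List.length_take, List.length_drop]; omega)))
    -- Since ζ and ζ̄ are 1 on the empty monomial, the syzygy reduces to X = X̄ at this element; odd
    -- weight gives X̄ = -X, hence X = 0.
    rw [conv_monomial] at h1
    rw [defect_syzygy, h3, h2] at h1
    simp only [List.length_nil, zero_add, Finset.range_one, Finset.sum_singleton, List.take_nil,
      List.drop_nil, hz, hbz, mul_one, one_mul] at h1
    rw [bar_of_mem _ (dualBasis_mem_component k I), ho.neg_one_pow] at h1
    linarith

/-! ### The two inclusions between O^k and the reduced span -/

/-- This is the fact that the annihilator of a subcoalgebra is a two-sided ideal of the convolution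
algebra. -/
theorem conv_eq_zero_of_comul_mem {l : ℕ} {C : Submodule ℚ (QSym l)} {h : QSym l}
    (hh : (Coalgebra.comul h : QSym l ⊗[ℚ] QSym l) ∈
      LinearMap.range (TensorProduct.map C.subtype C.subtype))
    {φ ψ : WithConv (QSym l →ₗ[ℚ] ℚ)} (h0 : (∀ x ∈ C, φ x = 0) ∨ ∀ x ∈ C, ψ x = 0) :
    (φ * ψ) h = 0 := by
  obtain ⟨t, ht⟩ := hh
  rw [LinearMap.convMul_apply, ← ht, ← LinearMap.comp_apply (TensorProduct.map _ _),
    ← TensorProduct.map_comp]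
  rcases h0 with h0 | h0
  · have : φ.ofConv ∘ₗ C.subtype = 0 := LinearMap.ext fun x => h0 x x.2
    rw [this, TensorProduct.map_zero_left]; simp
  · have : ψ.ofConv ∘ₗ C.subtype = 0 := LinearMap.ext fun x => h0 x x.2
    rw [this, TensorProduct.map_zero_right]; simp

theorem reducedSpan_mem_agreeing {l : ℕ} (k : Fin l → ℕ∞) :
    reducedSpan k ∈ agreeingSubcoalgebras component k (bar component (zeta l))
      (convInv (zeta l)) := by
  refine ⟨isGradedSubcoalgebra_reducedSpan k, fun h hh hk => ?_⟩
  rw [mem_reducedSpan_iff] at hh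
  rw [← sub_eq_zero]
  change defect l h = 0
  rw [← (dualBasis k).linearCombination_repr h, Finsupp.linearCombination_apply, Finsupp.sum,
    map_sum]
  refine Finset.sum_eq_zero fun I hI => ?_
  rw [Finsupp.mem_support_iff, dualBasis_repr] at hI
  rw [map_smul, defect_dualBasis k I (hh I hI), smul_zero]
  -- An index of unbounded total cannot occur in `h`, whose components all have degree bounded by
  -- `k`.
  by_contra hb
  refine hI ?_
  have : (⨆ n : {n : Fin l → ℕ // BoundedBy k n}, component n.1) ≤
      LinearMap.ker (genProd k I).ofConv := by
    refine iSup_le fun n x hx => ?_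
    rw [LinearMap.mem_ker]
    by_contra hne
    refine hb ?_
    rw [(mem_component_iff k n.1 x).mp hx I hne]
    exact n.2
  exact this hk

/-- A product of generators with an eliminated column has a factor annihilating `C`, hence
annihilates `C` itself by the ideal property, applied once on each side of that factor. -/
theorem le_reducedSpan {l : ℕ} (k : Fin l → ℕ∞) {C : Submodule ℚ (QSym l)}
    (hC : C ∈ agreeingSubcoalgebras component k (bar component (zeta l)) (convInv (zeta l))) :
    C ≤ reducedSpan k := by
  have hdef : ∀ c : {n : Fin l → ℕ // n ≠ 0}, Eliminated k c.1 →
      ∀ x ∈ C, genProd k [c] x = 0 := by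
    intro c hc x hx
    have h1 : homProj component c.1 x ∈ C := hC.1.homogeneous c.1 hx
    have h2 : homProj component c.1 x ∈ ⨆ n : {n : Fin l → ℕ // BoundedBy k n}, component n.1 :=
      Submodule.mem_iSup_of_mem (⟨c.1, hc.1⟩ : {n : Fin l → ℕ // BoundedBy k n})
        (homProj_mem c.1 x)
    rw [genProd_singleton_of_eliminated k c hc, defect, LinearMap.sub_apply, hC.2 _ h1 h2,
      sub_self, mul_zero]
  intro h hh
  rw [mem_reducedSpan_iff]
  intro I hI c hcI hc
  obtain ⟨P, Q, rfl⟩ := List.append_of_mem hcI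
  refine hI ?_
  rw [genProd_append, ← List.singleton_append, genProd_append]
  refine conv_eq_zero_of_comul_mem (hC.1.comul_mem h hh) (Or.inr fun x hx => ?_)
  exact conv_eq_zero_of_comul_mem (hC.1.comul_mem x hx) (Or.inl (hdef c hc))

theorem kOdd_eq_reducedSpan {l : ℕ} (k : Fin l → ℕ∞) : kOdd k = reducedSpan k :=
  le_antisymm (sSup_le fun _ hC => le_reducedSpan k hC) (le_sSup (reducedSpan_mem_agreeing k))

/-! ### Dimensions -/

/-- The reduced vector compositions of `n`. -/
def reducedComps {l : ℕ} (k : Fin l → ℕ∞) (n : Fin l → ℕ) : Set (VComp l) :=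
  {I | Reduced k I ∧ I.total = n}

theorem finite_reducedComps {l : ℕ} (k : Fin l → ℕ∞) (n : Fin l → ℕ) :
    (reducedComps k n).Finite :=
  (finite_weight_le l (weight n)).subset fun I hI => by
    change weight I.total ≤ _
    rw [hI.2]

theorem kOdd_inf_component {l : ℕ} (k : Fin l → ℕ∞) (n : Fin l → ℕ) :
    kOdd k ⊓ component n =
      Submodule.span ℚ (Set.range fun I : reducedComps k n => dualBasis k I.1) := by
  have : (Set.range fun I : reducedComps k n => dualBasis k I.1) =
      dualBasis k '' reducedComps k n := by
    rw [Set.image_eq_range]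
  rw [this]
  ext h
  rw [Submodule.mem_inf, kOdd_eq_reducedSpan, mem_reducedSpan_iff, mem_component_iff k,
    Module.Basis.mem_span_image]
  constructor
  · rintro ⟨h1, h2⟩ I hI
    exact ⟨h1 I (Finsupp.mem_support_iff.mp hI), h2 I (Finsupp.mem_support_iff.mp hI)⟩
  · intro H
    exact ⟨fun I hI => (H (Finsupp.mem_support_iff.mpr hI)).1,
      fun I hI => (H (Finsupp.mem_support_iff.mpr hI)).2⟩

theorem finiteDimensional_kOdd_inf_component {l : ℕ} (k : Fin l → ℕ∞) (n : Fin l → ℕ) :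
    FiniteDimensional ℚ ↥(kOdd k ⊓ component n) := by
  have := (finite_reducedComps k n).to_subtype
  rw [kOdd_inf_component]
  exact FiniteDimensional.span_of_finite ℚ (Set.finite_range _)

theorem finrank_kOdd_inf_component {l : ℕ} (k : Fin l → ℕ∞) (n : Fin l → ℕ) :
    Module.finrank ℚ ↥(kOdd k ⊓ component n) = (reducedComps k n).ncard := by
  have := (finite_reducedComps k n).fintype
  rw [kOdd_inf_component, finrank_span_eq_card, ← Nat.card_eq_fintype_card]
  · rfl
  · exact (dualBasis k).linearIndependent.comp _ Subtype.val_injective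


/-! ### Counting reduced vector compositions -/

open Classical in
/-- The generating function of the multidegrees of the surviving generators. -/
def survivingSeries {l : ℕ} (k : Fin l → ℕ∞) : MvPowerSeries (Fin l) ℚ :=
  fun n => if (n : Fin l → ℕ) ≠ 0 ∧ ¬ Eliminated k n then 1 else 0

/-- The multidegrees of the first column and of the other columns. -/
def headTail {l : ℕ} : VComp l → (Fin l →₀ ℕ) × (Fin l →₀ ℕ)
  | [] => 0
  | c :: I => (Finsupp.equivFunOnFinite.symm c.1, Finsupp.equivFunOnFinite.symm (VComp.total I))

theorem reducedComps_zero {l : ℕ} (k : Fin l → ℕ∞) : reducedComps k 0 = {[]} := by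
  ext I
  constructor
  · rintro ⟨-, h⟩
    rcases I with _ | ⟨c, I⟩
    · rfl
    · rw [VComp.total_cons] at h
      refine absurd ?_ c.2
      funext i
      have := congrFun h i
      simp only [Pi.add_apply, Pi.zero_apply] at this ⊢
      omega
  · rintro rfl
    exact ⟨fun c hc => absurd hc List.not_mem_nil, rfl⟩

-- Removing the first column gives the recursion for free words: a reduced composition of nonzero
-- total is a surviving column followed by a reduced composition of the remainder.
open Classical in
theorem ncard_reducedComps {l : ℕ} (k : Fin l → ℕ∞) (n : Fin l →₀ ℕ) (hn : n ≠ 0) :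
    (reducedComps k n).ncard = ∑ p ∈ Finset.HasAntidiagonal.antidiagonal n,
      (if (p.1 : Fin l → ℕ) ≠ 0 ∧ ¬ Eliminated k p.1 then 1 else 0) *
        (reducedComps k p.2).ncard := by
  have hcard : ∀ m : Fin l → ℕ,
      (reducedComps k m).ncard = (finite_reducedComps k m).toFinset.card :=
    fun m => Set.ncard_eq_toFinset_card _ _
  rw [hcard, Finset.card_eq_sum_card_fiberwise (f := headTail) (t := Finset.HasAntidiagonal.antidiagonal n)]
  · refine Finset.sum_congr rfl fun p hp => ?_
    rw [Finset.HasAntidiagonal.mem_antidiagonal] at hp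
    split_ifs with h
    · rw [one_mul, hcard, ← Finset.card_image_of_injective
        (finite_reducedComps k p.2).toFinset
        (List.cons_injective (a := (⟨p.1, h.1⟩ : {n : Fin l → ℕ // n ≠ 0})))]
      congr 1
      ext I
      simp only [Finset.mem_filter, Set.Finite.mem_toFinset, Finset.mem_image]
      constructor
      · rintro ⟨⟨h1, h2⟩, h3⟩
        rcases I with _ | ⟨c, I⟩
        -- The conventional value of `headTail` at the empty composition does no harm, because n ≠
        -- 0.
        · exact absurd (DFunLike.coe_injective h2.symm) hn
        · obtain ⟨h4, h5⟩ := Prod.ext_iff.mp h3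
          refine ⟨I, ⟨fun c hc => h1 c (List.mem_cons_of_mem _ hc), ?_⟩, ?_⟩
          · rw [← h5]; rfl
          · congr 1
            exact Subtype.ext (congrArg DFunLike.coe h4.symm)
      · rintro ⟨J, ⟨h1, h2⟩, rfl⟩
        refine ⟨⟨?_, ?_⟩, ?_⟩
        · intro c hc
          rcases List.mem_cons.mp hc with rfl | hc
          · exact h.2
          · exact h1 c hc
        · rw [VComp.total_cons, h2, ← hp]; rfl
        · refine Prod.ext ?_ ?_
          · exact Finsupp.equivFunOnFinite.symm_apply_apply p.1
          · change Finsupp.equivFunOnFinite.symm (VComp.total J) = p.2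
            rw [h2]
            exact Finsupp.equivFunOnFinite.symm_apply_apply p.2
    · rw [zero_mul, Finset.card_eq_zero, Finset.filter_eq_empty_iff]
      intro I hI h3
      rw [Set.Finite.mem_toFinset] at hI
      obtain ⟨h1, h2⟩ := hI
      rcases I with _ | ⟨c, I⟩
      · exact absurd (DFunLike.coe_injective h2.symm) hn
      · obtain ⟨h4, h5⟩ := Prod.ext_iff.mp h3
        have h6 : (p.1 : Fin l → ℕ) = c.1 := by rw [← h4]; rfl
        rw [h6] at h
        exact h ⟨c.2, h1 c List.mem_cons_self⟩
  · intro I hI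
    rw [Finset.mem_coe, Set.Finite.mem_toFinset] at hI
    obtain ⟨h1, h2⟩ := hI
    rw [Finset.mem_coe, Finset.HasAntidiagonal.mem_antidiagonal]
    rcases I with _ | ⟨c, I⟩
    · exact absurd (DFunLike.coe_injective h2.symm) hn
    · rw [VComp.total_cons] at h2
      exact DFunLike.coe_injective h2

theorem coeff_kOddHilbertSeries {l : ℕ} (k : Fin l → ℕ∞) (n : Fin l →₀ ℕ) :
    MvPowerSeries.coeff n (kOddHilbertSeries k) = ((reducedComps k n).ncard : ℚ) := by
  rw [← finrank_kOdd_inf_component]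
  rfl

open Classical in
theorem coeff_survivingSeries {l : ℕ} (k : Fin l → ℕ∞) (n : Fin l →₀ ℕ) :
    MvPowerSeries.coeff n (survivingSeries k) =
      if (n : Fin l → ℕ) ≠ 0 ∧ ¬ Eliminated k n then 1 else 0 := rfl

/-- The first-column recursion says H = 1 + S H; the 1 accounts for the empty composition. -/
theorem one_sub_survivingSeries_mul {l : ℕ} (k : Fin l → ℕ∞) :
    (1 - survivingSeries k) * kOddHilbertSeries k = 1 := by
  classical
  rw [sub_mul, one_mul, sub_eq_iff_eq_add]
  ext n
  rw [map_add, MvPowerSeries.coeff_mul, MvPowerSeries.coeff_one, coeff_kOddHilbertSeries]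
  simp only [coeff_kOddHilbertSeries, coeff_survivingSeries]
  by_cases hn : n = 0
  · subst hn
    rw [if_pos rfl, Finset.HasAntidiagonal.antidiagonal_zero, Finset.sum_singleton, Finsupp.coe_zero,
      reducedComps_zero]
    simp
  · rw [if_neg hn, zero_add, ncard_reducedComps k n hn]
    push_cast
    rfl

/-! ### Products of univariate power series in separate variables -/

/-- The product `∏ i, f i (t_i)`. -/
def sepProd {ι : Type*} [Fintype ι] (f : ι → PowerSeries ℚ) : MvPowerSeries ι ℚ :=
  fun n => ∏ i, PowerSeries.coeff (n i) (f i)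

theorem coeff_sepProd {ι : Type*} [Fintype ι] (f : ι → PowerSeries ℚ) (n : ι →₀ ℕ) :
    MvPowerSeries.coeff n (sepProd f) = ∏ i, PowerSeries.coeff (n i) (f i) := rfl

/-- Splitting an exponent vector as a sum of two is the same as splitting each coordinate
independently, so the Cauchy product distributes over the coordinates. -/
theorem sepProd_mul {ι : Type*} [Fintype ι] (f g : ι → PowerSeries ℚ) :
    sepProd (f * g) = sepProd f * sepProd g := by
  classical
  ext n
  rw [MvPowerSeries.coeff_mul, coeff_sepProd]
  simp only [coeff_sepProd, Pi.mul_apply, PowerSeries.coeff_mul, ← Finset.prod_mul_distrib]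
  rw [Finset.prod_univ_sum]
  refine Finset.sum_bij' (fun x _ => (Finsupp.equivFunOnFinite.symm fun i => (x i).1,
    Finsupp.equivFunOnFinite.symm fun i => (x i).2)) (fun p _ i => (p.1 i, p.2 i)) ?_ ?_ ?_ ?_ ?_
  · intro x hx
    rw [Fintype.mem_piFinset] at hx
    rw [Finset.HasAntidiagonal.mem_antidiagonal]
    ext i
    exact Finset.HasAntidiagonal.mem_antidiagonal.mp (hx i)
  · intro p hp
    rw [Finset.HasAntidiagonal.mem_antidiagonal] at hp
    rw [Fintype.mem_piFinset]
    intro i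
    rw [Finset.HasAntidiagonal.mem_antidiagonal, ← hp]
    rfl
  · intro x _
    rfl
  · intro p _
    refine Prod.ext ?_ ?_ <;> ext i <;> rfl
  · intro x _
    rfl

theorem sepProd_one {ι : Type*} [Fintype ι] : sepProd (1 : ι → PowerSeries ℚ) = 1 := by
  classical
  ext n
  rw [coeff_sepProd, MvPowerSeries.coeff_one]
  simp only [Pi.one_apply, PowerSeries.coeff_one, Finset.prod_boole, Finset.mem_univ,
    forall_const]
  refine if_congr ?_ rfl rfl
  rw [Finsupp.ext_iff]
  rfl

/-- Substitution of the variable `t_i` in a univariate power series. -/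
def inVar {ι : Type*} [DecidableEq ι] (i : ι) : PowerSeries ℚ →ₗ[ℚ] MvPowerSeries ι ℚ where
  toFun p := fun n => if n = Finsupp.single i (n i) then PowerSeries.coeff (n i) p else 0
  map_add' p q := by
    funext n
    change _ = (if n = Finsupp.single i (n i) then PowerSeries.coeff (n i) p else 0) +
      (if n = Finsupp.single i (n i) then PowerSeries.coeff (n i) q else 0)
    rw [ite_add_ite, map_add, add_zero]
  map_smul' a p := by
    funext n
    change _ = a • (if n = Finsupp.single i (n i) then PowerSeries.coeff (n i) p else 0)
    rw [smul_ite, map_smul, smul_zero]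

theorem coeff_inVar {ι : Type*} [DecidableEq ι] (i : ι) (p : PowerSeries ℚ) (n : ι →₀ ℕ) :
    MvPowerSeries.coeff n (inVar i p) =
      if n = Finsupp.single i (n i) then PowerSeries.coeff (n i) p else 0 := rfl

theorem inVar_X_pow {ι : Type*} [DecidableEq ι] (i : ι) (m : ℕ) :
    inVar i (PowerSeries.X ^ m) = MvPowerSeries.X i ^ m := by
  ext n
  rw [coeff_inVar, MvPowerSeries.coeff_X_pow, PowerSeries.coeff_X_pow, ← ite_and]
  refine if_congr ⟨?_, ?_⟩ rfl rfl
  · rintro ⟨h1, h2⟩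
    rw [h1, h2]
  · rintro h
    have : n i = m := by rw [h, Finsupp.single_eq_same]
    exact ⟨by rw [this, h], this⟩

theorem inVar_one {ι : Type*} [DecidableEq ι] (i : ι) : inVar i 1 = 1 := by
  simpa using inVar_X_pow i 0

/-- This links the coefficientwise form, suited to counting, with the product form of the
polynomials in the statement. By multiplicativity it suffices to treat families with a single
nontrivial factor. -/
theorem sepProd_eq_prod {ι : Type*} [Fintype ι] [DecidableEq ι] (f : ι → PowerSeries ℚ) :
    sepProd f = ∏ i, inVar i (f i) := by
  let F : (ι → PowerSeries ℚ) →* MvPowerSeries ι ℚ := ⟨⟨sepProd, sepProd_one⟩, sepProd_mul⟩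
  have h1 : F f = ∏ i, F (Pi.mulSingle i (f i)) := by
    conv_lhs => rw [← Finset.univ_prod_mulSingle f]
    rw [map_prod]
  change F f = _
  rw [h1]
  refine Finset.prod_congr rfl fun i _ => ?_
  change sepProd _ = _
  ext n
  rw [coeff_sepProd, coeff_inVar, ← Finset.mul_prod_erase _ _ (Finset.mem_univ i),
    Pi.mulSingle_eq_same]
  have h2 : ∏ j ∈ Finset.univ.erase i, PowerSeries.coeff (n j)
      ((Pi.mulSingle i (f i) : ι → PowerSeries ℚ) j) = if n = Finsupp.single i (n i) then 1 else 0 := by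
    rw [Finset.prod_congr rfl (g := fun j => if n j = 0 then (1 : ℚ) else 0), Finset.prod_boole]
    · congr 1
      refine propext ⟨fun h => ?_, fun h j hj => ?_⟩
      · ext j
        by_cases hj : j = i
        · subst hj; rw [Finsupp.single_eq_same]
        · rw [Finsupp.single_eq_of_ne hj]
          exact h j (Finset.mem_erase.mpr ⟨hj, Finset.mem_univ j⟩)
      · rw [h, Finsupp.single_eq_of_ne (Finset.ne_of_mem_erase hj)]
    · intro j hj
      rw [Pi.mulSingle_eq_of_ne (Finset.ne_of_mem_erase hj), PowerSeries.coeff_one]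
  rw [h2, mul_ite, mul_one, mul_zero]

/-! ### The univariate series -/

/-- The sum of the powers `t^m` with `m ≤ κ` and `m ≡ b` modulo `2`. -/
def parityGeom (κ : ℕ∞) (b : ℕ) : PowerSeries ℚ :=
  PowerSeries.mk fun m => if m % 2 = b ∧ (m : ℕ∞) ≤ κ then 1 else 0

/-- The univariate version of `cutTerm`. -/
def cutSeries (κ : ℕ∞) (b : ℕ) : PowerSeries ℚ :=
  if κ = ⊤ then 0 else PowerSeries.X ^ (2 * ⌊((κ.toNat : ℚ) - (b : ℚ)) / 2⌋ + 2).toNat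

/-- Telescoping of a geometric series of ratio t² starting at t^b: the first exponent beyond κ is b
+ 2⌊(κ - b)/2⌋ + 2. For κ = 0 and b = 1 the floor is -1 and the cut exponent is 0, so both sides
vanish. -/
theorem one_sub_sq_mul_parityGeom (κ : ℕ∞) {b : ℕ} (hb : b < 2) :
    (1 - PowerSeries.X ^ 2) * parityGeom κ b = PowerSeries.X ^ b * (1 - cutSeries κ b) := by
  ext m
  rw [sub_mul, one_mul, map_sub, PowerSeries.coeff_X_pow_mul', mul_sub, mul_one, map_sub,
    PowerSeries.coeff_X_pow]
  simp only [parityGeom, PowerSeries.coeff_mk]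
  induction κ with
  | top =>
    rw [cutSeries, if_pos rfl, mul_zero, map_zero]
    simp only [le_top, and_true]
    split_ifs <;> first | omega | norm_num
  | coe K =>
    rw [cutSeries, if_neg (ENat.natCast_ne_top K), ← pow_add, PowerSeries.coeff_X_pow,
      ENat.toNat_natCast]
    set f := ⌊((K : ℚ) - (b : ℚ)) / 2⌋ with hf
    -- The floor is characterised by two integer inequalities, after which the comparison of
    -- coefficients is linear arithmetic.
    have h1 : 2 * f ≤ (K : ℤ) - b := by
      have := Int.floor_le (((K : ℚ) - (b : ℚ)) / 2)
      rw [← hf, le_div_iff₀ (by norm_num)] at this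
      have h : ((2 * f : ℤ) : ℚ) ≤ ((K - b : ℤ) : ℚ) := by push_cast; linarith
      exact_mod_cast h
    have h2 : (K : ℤ) - b < 2 * f + 2 := by
      have := Int.lt_floor_add_one (((K : ℚ) - (b : ℚ)) / 2)
      rw [← hf, div_lt_iff₀ (by norm_num)] at this
      have h : ((K - b : ℤ) : ℚ) < ((2 * f + 2 : ℤ) : ℚ) := by push_cast; linarith
      exact_mod_cast h
    simp only [Nat.cast_le]
    split_ifs <;> first | omega | norm_num

theorem one_sub_sq_mul_geom :
    (1 - PowerSeries.X ^ 2) * (PowerSeries.mk fun _ => (1 : ℚ)) = 1 + PowerSeries.X := by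
  ext m
  rw [sub_mul, one_mul, map_sub, map_add, PowerSeries.coeff_X_pow_mul', PowerSeries.coeff_one,
    PowerSeries.coeff_X, PowerSeries.coeff_mk, PowerSeries.coeff_mk]
  split_ifs <;> first | omega | norm_num

/-! ### The rational function -/

theorem coe_cutTerm {l : ℕ} (i : Fin l) (κ : ℕ∞) (b : ℕ) :
    (cutTerm i κ b : MvPowerSeries (Fin l) ℚ) = inVar i (cutSeries κ b) := by
  rw [cutTerm, cutSeries]
  split_ifs
  · simp
  · rw [inVar_X_pow]; simp

theorem inVar_mul {ι : Type*} [DecidableEq ι] [Fintype ι] (i : ι) (p q : PowerSeries ℚ) :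
    inVar i (p * q) = inVar i p * inVar i q := by
  have h : ∀ p : PowerSeries ℚ, inVar i p = sepProd (Pi.mulSingle i p) := by
    intro p
    rw [sepProd_eq_prod, Finset.prod_eq_single i]
    · rw [Pi.mulSingle_eq_same]
    · intro j _ hj
      rw [Pi.mulSingle_eq_of_ne hj, inVar_one]
    · simp
  rw [h, h, h, ← sepProd_mul, Pi.mulSingle_mul]

theorem coe_hilbertNum (l : ℕ) : (hilbertNum l : MvPowerSeries (Fin l) ℚ) =
    sepProd fun _ => 1 - PowerSeries.X ^ 2 := by
  rw [sepProd_eq_prod, hilbertNum]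
  change MvPolynomial.coeToMvPowerSeries.ringHom _ = _
  rw [map_prod]
  refine Finset.prod_congr rfl fun i _ => ?_
  rw [map_sub, map_sub, inVar_one, inVar_X_pow]
  simp

theorem coe_hilbertDen {l : ℕ} (k : Fin l → ℕ∞) :
    (hilbertDen k : MvPowerSeries (Fin l) ℚ) =
      (sepProd fun _ => 1 - PowerSeries.X ^ 2) - (sepProd fun _ => 1 + PowerSeries.X) +
        ∑ b : Fin l → Fin 2 with Even (∑ i, (b i : ℕ)),
          sepProd fun i => PowerSeries.X ^ (b i : ℕ) * (1 - cutSeries (k i) (b i)) := by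
  rw [← coe_hilbertNum, hilbertDen, MvPolynomial.coe_add, hilbertNum]
  congr 1
  · rw [← MvPolynomial.coeToMvPowerSeries.ringHom_apply, map_sub]
    refine congrArg₂ _ rfl ?_
    rw [sepProd_eq_prod]
    rw [map_prod]
    refine Finset.prod_congr rfl fun i _ => ?_
    rw [map_add, map_add, inVar_one, ← pow_one (PowerSeries.X), inVar_X_pow]
    simp
  · rw [← MvPolynomial.coeToMvPowerSeries.ringHom_apply, map_sum]
    refine Finset.sum_congr rfl fun b _ => ?_
    rw [map_prod, sepProd_eq_prod]
    refine Finset.prod_congr rfl fun i _ => ?_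
    rw [inVar_mul, inVar_X_pow, map_sub, inVar_one, ← coe_cutTerm, map_mul, map_sub, map_one]
    simp

/-- Surviving degrees are all degrees minus the eliminated ones. The eliminated degrees are sorted
by their parity vector b; evenness of the weight depends only on b, and the bound by `k` is imposed
coordinate by coordinate, so each class is a separated product. -/
theorem one_sub_survivingSeries {l : ℕ} (k : Fin l → ℕ∞) :
    1 - survivingSeries k = 1 - (sepProd fun _ => PowerSeries.mk fun _ => 1) +
      ∑ b : Fin l → Fin 2 with Even (∑ i, (b i : ℕ)), sepProd fun i => parityGeom (k i) (b i) := by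
  classical
  ext n
  have hgeom : MvPowerSeries.coeff n
      (sepProd fun _ : Fin l => PowerSeries.mk fun _ => (1 : ℚ)) = 1 := by
    rw [coeff_sepProd]; simp
  have hsum : ∑ b : Fin l → Fin 2 with Even (∑ i, (b i : ℕ)),
      MvPowerSeries.coeff n (sepProd fun i => parityGeom (k i) (b i)) =
        if Eliminated k n then 1 else 0 := by
    -- Only the parity vector of n itself can contribute to the coefficient at n.
    let β : Fin l → Fin 2 := fun i => ⟨n i % 2, Nat.mod_lt _ two_pos⟩
    have heven : Even (∑ i, (β i : ℕ)) ↔ Even (weight n) := by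
      rw [Nat.even_iff, Nat.even_iff, weight, Finset.sum_nat_mod Finset.univ 2 n]
    have hcoeff : ∀ b : Fin l → Fin 2,
        MvPowerSeries.coeff n (sepProd fun i => parityGeom (k i) (b i)) =
          if b = β ∧ BoundedBy k n then 1 else 0 := by
      intro b
      rw [coeff_sepProd]
      simp only [parityGeom, PowerSeries.coeff_mk]
      rw [Finset.prod_boole]
      congr 1
      refine propext ⟨fun h => ?_, ?_⟩
      · exact ⟨funext fun i => Fin.ext (h i (Finset.mem_univ i)).1.symm,
          fun i => (h i (Finset.mem_univ i)).2⟩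
      · rintro ⟨rfl, h⟩ i _
        exact ⟨rfl, h i⟩
    simp only [hcoeff]
    rw [Finset.sum_filter, Finset.sum_eq_single β]
    · rw [← ite_and]
      refine if_congr ?_ rfl rfl
      rw [heven, Eliminated]
      tauto
    · intro b _ hb
      simp [hb]
    · simp
  rw [map_add, map_sub, map_sub, hgeom, map_sum, hsum, MvPowerSeries.coeff_one,
    coeff_survivingSeries]
  by_cases hn : n = 0
  · subst hn
    -- Degree 0 satisfies the elimination condition although it carries no generator, so its terms
    -- in the two series cancel.
    have : Eliminated k 0 := by
      refine ⟨fun i => by simp, by simp [weight]⟩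
    simp [this]
  · have hn' : (n : Fin l → ℕ) ≠ 0 := fun h => hn (DFunLike.coe_injective h)
    rw [if_neg hn]
    by_cases h : Eliminated k n <;> simp [h, hn']

theorem hilbertNum_mul_one_sub {l : ℕ} (k : Fin l → ℕ∞) :
    (hilbertNum l : MvPowerSeries (Fin l) ℚ) * (1 - survivingSeries k) = hilbertDen k := by
  rw [one_sub_survivingSeries, coe_hilbertDen, coe_hilbertNum, mul_add, mul_sub, mul_one,
    ← sepProd_mul, Finset.mul_sum]
  congr 1
  · congr 2
    funext i
    exact one_sub_sq_mul_geom
  · refine Finset.sum_congr rfl fun b _ => ?_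
    rw [← sepProd_mul]
    congr 1
    funext i
    exact one_sub_sq_mul_parityGeom (k i) (b i).2

/-- Both factors of `hilbertNum_mul_one_sub` have constant term 1, because S has none; this makes
the denominator invertible. -/
theorem constantCoeff_hilbertDen {l : ℕ} (k : Fin l → ℕ∞) :
    MvPowerSeries.constantCoeff (hilbertDen k : MvPowerSeries (Fin l) ℚ) = 1 := by
  rw [← hilbertNum_mul_one_sub, map_mul, map_sub, map_one, coe_hilbertNum,
    ← MvPowerSeries.coeff_zero_eq_constantCoeff_apply,
    ← MvPowerSeries.coeff_zero_eq_constantCoeff_apply, coeff_survivingSeries, coeff_sepProd]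
  simp

end LevelQSym

end

theorem propositionP (l : ℕ) (k : Fin l → ℕ∞) :
    (∀ n : Fin l → ℕ,
      FiniteDimensional ℚ ↥(LevelQSym.kOdd k ⊓ LevelQSym.component n)) ∧
    IsUnit (LevelQSym.hilbertDen k : MvPowerSeries (Fin l) ℚ) ∧
    LevelQSym.kOddHilbertSeries k =
      (LevelQSym.hilbertNum l : MvPowerSeries (Fin l) ℚ) *
        (LevelQSym.hilbertDen k : MvPowerSeries (Fin l) ℚ)⁻¹ := by
  have hc := LevelQSym.constantCoeff_hilbertDen k
  refine ⟨LevelQSym.finiteDimensional_kOdd_inf_component k, ?_, ?_⟩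
  · rw [MvPowerSeries.isUnit_iff_constantCoeff, hc]
    exact isUnit_one
  · rw [MvPowerSeries.eq_mul_inv_iff_mul_eq (by rw [hc]; exact one_ne_zero),
      ← LevelQSym.hilbertNum_mul_one_sub, mul_left_comm, mul_comm (LevelQSym.kOddHilbertSeries k),
      LevelQSym.one_sub_survivingSeries_mul, mul_one]
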